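/- Let $d\ge 1$. A Lévy measure on $\mathbb R^d$ is a $\sigma$-finite Borel measure $\nu$ with $\nu(\{0\})=0$ and $\int_{\mathbb R^d}(1\wedge|y|^2)\,\nu(dy)<\infty$; its symbol is $$\psi(u)=-\int_{\mathbb R^d}\big(e^{i\langle u,z\rangle}-1-i\langle u,z\rangle 1_{\{|z|\le 1\}}\big)\,\nu(dz),\qquad u\in\mathbb R^d.$$ Let $L=(L_t)_{t\ge0}$ be a $d$-dimensional pure-jump Lévy process without drift and with Lévy measure $\nu$, i.e. $E[e^{i\langle u,L_t\rangle}]=e^{-t\psi(u)}$ for all $t\ge0$, $u\in\mathbb R^d$, and let $R_tf(x)=E[f(x+L_t)]$ for $f\in C_b(\mathbb R^d)$ (the continuous bounded functions $f:\mathbb R^d\to\mathbb R$), $x\in\mathbb R^d$, $t\ge 0$. Assume that $\nu(A)\ge\nu_1(A)$ for every Borel set $A\subset\mathbb R^d$, where $\nu_1$ is a Lévy measure on $\mathbb R^d$ whose symbol $\psi_1$ satisfies, for some $\alpha\in(0,2)$ and some constants $c_1,c_2,M>0$, $$c_1|y|^\alpha\le \operatorname{Re}\psi_1(y)\le c_2|y|^\alpha\qquad\text{for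 all } y\in\mathbb R^d \text{ with } |y|>M.$$ Then, for every $t>0$ and $f\in C_b(\mathbb R^d)$, the function $R_tf$ belongs to $C_b^1(\mathbb R^d)$ (it is $C^1$, and it and its first derivative are bounded), and there is a constant $c>0$, independent of $f$ and $t$, such that for all $f\in C_b(\mathbb R^d)$ and $t\in(0,1]$ $$\sup_{x\in\mathbb R^d}|DR_tf(x)|\le\frac{c}{t^{1/\alpha}}\,\sup_{x\in\mathbb R^d}|f(x)|.$$ -/

import Mathlib

open MeasureTheory ProbabilityTheory Filter Set
open scoped NNReal ENNReal Topology BoundedContinuousFunction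

namespace LevyGradient

/-- A Lévy measure on `ℝ^d`: a σ-finite Borel measure `ν` with `ν {0} = 0` and
`∫ (1 ∧ |y|²) ν(dy) < ∞`. -/
structure IsLevyMeasure {d : ℕ} (ν : Measure (EuclideanSpace ℝ (Fin d))) : Prop where
  sigmaFinite : SigmaFinite ν
  zero_singleton : ν {0} = 0
  lintegral_lt_top : ∫⁻ y, ENNReal.ofReal (min 1 (‖y‖ ^ 2)) ∂ν < ∞

/-- The symbol (exponent) of a Lévy measure `ν`,
`ψ(u) = - ∫ (e^{i⟨u,z⟩} - 1 - i⟨u,z⟩ 1_{|z| ≤ 1}) ν(dz)`.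
The integrand is `ν`-integrable whenever `ν` is a Lévy measure. -/
noncomputable def symbol {d : ℕ} (ν : Measure (EuclideanSpace ℝ (Fin d)))
    (u : EuclideanSpace ℝ (Fin d)) : ℂ :=
  -∫ z, (Complex.exp (Complex.I * (inner ℝ u z : ℝ)) - 1
      - Complex.I * (inner ℝ u z : ℝ) * (Metric.closedBall 0 1).indicator (fun _ => (1 : ℂ)) z) ∂ν

/-- A path `[0, ∞) → E` that is right continuous and has left limits (at `t = 0` the second
condition is void). -/
def IsCadlag {E : Type*} [TopologicalSpace E] (x : ℝ≥0 → E) : Prop :=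
  ∀ t : ℝ≥0, ContinuousWithinAt x (Ici t) t ∧ ∃ l : E, Tendsto x (𝓝[<] t) (𝓝 l)

/-- A `d`-dimensional Lévy process with respect to a filtration `ℱ` on `(Ω, P)`. -/
structure IsLevyProcess {d : ℕ} {Ω : Type*} [mΩ : MeasurableSpace Ω] (ℱ : Filtration ℝ≥0 mΩ)
    (P : Measure Ω) (L : ℝ≥0 → Ω → EuclideanSpace ℝ (Fin d)) : Prop where
  adapted : Adapted ℱ L
  zero : ∀ᵐ ω ∂P, L 0 ω = 0
  cadlag : ∀ᵐ ω ∂P, IsCadlag (fun t => L t ω)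
  continuous_in_probability : ∀ t : ℝ≥0, TendstoInMeasure P L (𝓝 t) (L t)
  stationary_increments : ∀ s t h : ℝ≥0,
    IdentDistrib (fun ω => L (s + h) ω - L s ω) (fun ω => L (t + h) ω - L t ω) P P
  indep_increments : ∀ s t : ℝ≥0, s ≤ t →
    Indep (MeasurableSpace.comap (fun ω => L t ω - L s ω) inferInstance) (ℱ s) P

/-- `L` is a pure-jump process without drift and with jump measure `ν`: in the
Lévy-Khintchine formula the Gaussian part and the drift vanish, so that
`E[e^{i⟨u, L_t⟩}] = e^{-t ψ(u)}` where `ψ` is the symbol of the Lévy measure `ν`. -/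
structure IsPureJump {d : ℕ} {Ω : Type*} [MeasurableSpace Ω] (P : Measure Ω)
    (L : ℝ≥0 → Ω → EuclideanSpace ℝ (Fin d)) (ν : Measure (EuclideanSpace ℝ (Fin d))) :
    Prop where
  isLevyMeasure : IsLevyMeasure ν
  charFun_eq : ∀ (t : ℝ≥0) (u : EuclideanSpace ℝ (Fin d)),
    ∫ ω, Complex.exp (Complex.I * (inner ℝ u (L t ω) : ℝ)) ∂P
      = Complex.exp (-(((t : ℝ) : ℂ) * symbol ν u))

/-- The convolution Markov semigroup of `L`: `R_t f(x) = E[f(x + L_t)]`. -/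
noncomputable def semigroup {d : ℕ} {Ω : Type*} [MeasurableSpace Ω] (P : Measure Ω)
    (L : ℝ≥0 → Ω → EuclideanSpace ℝ (Fin d)) (t : ℝ≥0)
    (f : EuclideanSpace ℝ (Fin d) →ᵇ ℝ) (x : EuclideanSpace ℝ (Fin d)) : ℝ :=
  ∫ ω, f (x + L t ω) ∂P

/-- `g ∈ C_b^1(ℝ^d)`: `g` is of class `C^1`, and `g` and its derivative are bounded. -/
structure IsCb1 {d : ℕ} (g : EuclideanSpace ℝ (Fin d) → ℝ) : Prop where
  contDiff : ContDiff ℝ 1 g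
  bounded : ∃ C : ℝ, ∀ x, |g x| ≤ C
  bounded_fderiv : ∃ C : ℝ, ∀ x, ‖fderiv ℝ g x‖ ≤ C

/-- The gradient hypothesis with exponent `α ∈ (0,2)` for a family of operators
`R_t` on `C_b(ℝ^d)`: one has `R_t (C_b) ⊆ C_b^1` for all `t > 0`, and there is a constant `c > 0`,
independent of `f` and `t`, with `sup_x |D R_t f(x)| ≤ (c / t^{1/α}) sup_x |f(x)|`
for all `f ∈ C_b(ℝ^d)` and `t ∈ (0,1]`. -/
structure GradientHypothesis {d : ℕ}
    (R : ℝ≥0 → (EuclideanSpace ℝ (Fin d) →ᵇ ℝ) → EuclideanSpace ℝ (Fin d) → ℝ)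
    (α : ℝ) : Prop where
  exponent_mem : α ∈ Ioo (0 : ℝ) 2
  maps_to : ∀ t : ℝ≥0, 0 < t → ∀ f, IsCb1 (R t f)
  gradient_le : ∃ c : ℝ, 0 < c ∧ ∀ (f : EuclideanSpace ℝ (Fin d) →ᵇ ℝ) (t : ℝ≥0), 0 < t → t ≤ 1 →
    ∀ x, ‖fderiv ℝ (R t f) x‖ ≤ c / (t : ℝ) ^ (1 / α) * ‖f‖

end LevyGradient

/-! The law of `L t` is rescaled by `r = (t ∧ 1)^{1/α}`, and its characteristic function is split
into two factors. One factor comes from the jumps of `ν₁` of size at most `r`, run for time `s = t ∧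
1 = r^α`. After division by `r` these jumps form a Lévy measure `N` on the unit ball. The other
factor `χ` collects all remaining jumps of `t • ν`.

Two estimates on `N` hold uniformly in `r`. First, `∫ |y|² dN ≤ C`: by
`IsLevyMeasure.exists_integral_min_le` the upper bound on `Re ψ₁`, averaged over a Gaussian
frequency, gives `∫ min(1, |z/r|²) dν₁ ≤ C r^{-α}`. Second, `Re ψ_N(2πw) ≥ c₁|w|^α - B`: this is the
lower bound on `Re ψ₁`, since discarding the jumps larger than `r` costs only a constant. As `N` has
bounded support, `exp(-ψ_N)` is smooth, and its derivatives are at most a polynomial times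
`exp(-c₁|w|^α)`. Its Fourier transform and the gradient of that transform are therefore bounded in
`L¹` by a constant `K` independent of `r` (`exists_lintegral_fourier_exp_neg_symbol_le`).

The factor `χ` is an infinitely divisible characteristic function about which nothing else is known.
Multiplication by it is convolution with a probability law on the Fourier side, so it increases no
`L¹` norm; this is the content of `IsFourierContraction`. Hence `r⁻¹ L_t` has a density whose
gradient has `L¹` norm at most `K`. Moving the derivative from the bounded function onto the density
gives a gradient bound `K ‖f‖` at scale one, and undoing the dilation produces the factor `1/r`,
which is `t^{-1/α}` for `t ≤ 1`. -/

namespace LevyGradient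

open scoped FourierTransform RealInnerProductSpace

/-! ### Fourier multipliers that contract the `L¹` norm of transforms -/

section Multiplier

variable {E : Type} [NormedAddCommGroup E] [InnerProductSpace ℝ E] [FiniteDimensional ℝ E]
  [MeasurableSpace E] [BorelSpace E]

/-- A function `χ` bounded by one which, as a Fourier multiplier, does not increase the `L¹` norm
of Fourier transforms. Characteristic functions of probability measures have this property, and it
is stable under pointwise limits. -/
structure IsFourierContraction (χ : E → ℂ) : Prop where
  measurable : Measurable χ
  norm_le_one : ∀ w, ‖χ w‖ ≤ 1
  lintegral_le : ∀ {V : Type} [NormedAddCommGroup V] [NormedSpace ℂ V] [CompleteSpace V]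
    (G : E → V), Integrable G →
      ∫⁻ x, ‖𝓕 (fun w => χ w • G w) x‖ₑ ≤ ∫⁻ x, ‖𝓕 G x‖ₑ

theorem IsFourierContraction.integrable_smul {χ : E → ℂ} (hχ : IsFourierContraction χ)
    {V : Type*} [NormedAddCommGroup V] [NormedSpace ℂ V] {G : E → V} (hG : Integrable G) :
    Integrable (fun w => χ w • G w) := by
  refine hG.mono (hχ.measurable.aestronglyMeasurable.smul hG.1) (.of_forall fun w => ?_)
  rw [norm_smul]
  exact mul_le_of_le_one_left (norm_nonneg _) (hχ.norm_le_one w)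

theorem IsFourierContraction.one : IsFourierContraction (fun _ : E => (1 : ℂ)) where
  measurable := measurable_const
  norm_le_one := by simp
  lintegral_le G _ := by simp

theorem IsFourierContraction.mul {χ χ' : E → ℂ} (hχ : IsFourierContraction χ)
    (hχ' : IsFourierContraction χ') : IsFourierContraction (fun w => χ w * χ' w) where
  measurable := hχ.measurable.mul hχ'.measurable
  norm_le_one w := by
    rw [norm_mul]
    exact mul_le_one₀ (hχ.norm_le_one w) (norm_nonneg _) (hχ'.norm_le_one w)
  lintegral_le G hG := by
    simp only [mul_smul]
    exact (hχ.lintegral_le _ (hχ'.integrable_smul hG)).trans (hχ'.lintegral_le G hG)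

theorem IsFourierContraction.pow {χ : E → ℂ} (hχ : IsFourierContraction χ) (n : ℕ) :
    IsFourierContraction (fun w => χ w ^ n) := by
  induction n with
  | zero => simpa using .one
  | succ n ih => simpa [pow_succ] using ih.mul hχ

theorem continuous_fourier_of_integrable {V : Type*} [NormedAddCommGroup V] [NormedSpace ℂ V]
    {G : E → V} (hG : Integrable G) : Continuous (𝓕 G) :=
  VectorFourier.fourierIntegral_continuous Real.continuous_fourierChar
    (by exact continuous_inner) hG

/-- Dominated convergence gives pointwise convergence of the transforms, and Fatou's lemma passes
the `L¹` bound to the limit. -/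
theorem IsFourierContraction.of_tendsto {χ : ℕ → E → ℂ} {χ' : E → ℂ}
    (h : ∀ᶠ n in atTop, IsFourierContraction (χ n))
    (hlim : ∀ w, Tendsto (fun n => χ n w) atTop (𝓝 (χ' w))) : IsFourierContraction χ' := by
  obtain ⟨n₀, hn₀⟩ := eventually_atTop.1 h
  wlog h0 : n₀ = 0 generalizing χ n₀
  · exact this (χ := fun n => χ (n + n₀)) (.of_forall fun n => hn₀ _ (by omega))
      (fun w => (hlim w).comp (tendsto_add_atTop_nat n₀)) 0 (fun n _ => hn₀ _ (by omega)) rfl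
  replace hn₀ : ∀ n, IsFourierContraction (χ n) := fun n => hn₀ n (by omega)
  refine ⟨measurable_of_tendsto_metrizable (fun n => (hn₀ n).measurable)
    (tendsto_pi_nhds.2 hlim), fun w => le_of_tendsto (hlim w).norm
      (.of_forall fun n => (hn₀ n).norm_le_one w), fun {V} _ _ _ G hG => ?_⟩
  have hF : ∀ x, Tendsto (fun n => 𝓕 (fun w => χ n w • G w) x) atTop
      (𝓝 (𝓕 (fun w => χ' w • G w) x)) := fun x => by
    simp only [Real.fourier_eq]
    refine tendsto_integral_of_dominated_convergence (fun w => ‖G w‖)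
      (fun n => ?_) hG.norm (fun n => .of_forall fun w => ?_) (.of_forall fun w => ?_)
    · exact ((Real.fourierIntegral_convergent_iff x).2 ((hn₀ n).integrable_smul hG)).1
    · rw [Circle.norm_smul, norm_smul]
      exact mul_le_of_le_one_left (norm_nonneg _) ((hn₀ n).norm_le_one w)
    · exact ((hlim w).smul_const _).const_smul _
  calc ∫⁻ x, ‖𝓕 (fun w => χ' w • G w) x‖ₑ
      = ∫⁻ x, liminf (fun n => ‖𝓕 (fun w => χ n w • G w) x‖ₑ) atTop :=
        lintegral_congr fun x => ((hF x).enorm.liminf_eq).symm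
    _ ≤ liminf (fun n => ∫⁻ x, ‖𝓕 (fun w => χ n w • G w) x‖ₑ) atTop :=
        lintegral_liminf_le fun n =>
          (continuous_fourier_of_integrable ((hn₀ n).integrable_smul hG)).enorm.measurable
    _ ≤ ∫⁻ x, ‖𝓕 G x‖ₑ :=
        liminf_le_of_frequently_le' (.of_forall fun n => (hn₀ n).lintegral_le G hG)

/-- By Fubini, a characteristic function as multiplier averages translates of `𝓕 G`. The factor `c /
(2π)` reconciles the kernel `e^{i⟨z,w⟩}` of `charFun` with the kernel `e^{-2πi⟨w,x⟩}` of `𝓕`. -/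
theorem fourier_charFun_smul (μ : Measure E) [IsFiniteMeasure μ] (c : ℝ)
    {V : Type*} [NormedAddCommGroup V] [NormedSpace ℂ V] [CompleteSpace V] {G : E → V}
    (hG : Integrable G) (x : E) :
    𝓕 (fun w => charFun μ (c • w) • G w) x
      = ∫ z, 𝓕 G (x - (c / (2 * Real.pi)) • z) ∂μ := by
  have key : ∀ z w : E, Real.fourierChar (-⟪w, x - (c / (2 * Real.pi)) • z⟫) • G w
      = Real.fourierChar (-⟪w, x⟫) • (Complex.exp (⟪z, c • w⟫ * Complex.I) • G w) := fun z w => by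
    rw [Circle.smul_def, Circle.smul_def, smul_smul, Real.fourierChar_apply, Real.fourierChar_apply,
      ← Complex.exp_add]
    congr 2
    rw [inner_sub_right, inner_smul_right, inner_smul_right, real_inner_comm w z]
    push_cast
    field_simp
    ring
  simp only [Real.fourier_eq, key]
  rw [integral_integral_swap]
  · refine integral_congr_ae (.of_forall fun w => ?_)
    simp only [charFun_apply]
    rw [← integral_smul_const, Circle.smul_def, ← integral_smul]
    rfl
  · have h1 : Integrable (fun p : E × E => ‖G p.2‖) (μ.prod volume) := hG.norm.comp_snd μ
    refine h1.mono ?_ (.of_forall fun p => ?_)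
    · have h2 : AEStronglyMeasurable (fun p : E × E => G p.2) (μ.prod volume) := hG.1.comp_snd
      have h3 : Continuous fun p : E × E => Real.fourierChar (-⟪p.2, x⟫) := by fun_prop
      have h4 : Continuous fun p : E × E => Complex.exp (⟪p.1, c • p.2⟫ * Complex.I) := by fun_prop
      have h5 : Continuous fun p : E × E => (Real.fourierChar (-⟪p.2, x⟫) : ℂ) := by fun_prop
      exact h5.aestronglyMeasurable.smul (h4.aestronglyMeasurable.smul h2)
    · simp [Function.uncurry, norm_smul, Complex.norm_exp_ofReal_mul_I]

/-- An average of translates, of total weight at most one, has no larger `L¹` norm, because Lebesgue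
measure is translation invariant. -/
theorem IsFourierContraction.charFun {μ : Measure E} (hμ : μ univ ≤ 1) (c : ℝ) :
    IsFourierContraction (fun w => charFun μ (c • w)) := by
  have : IsFiniteMeasure μ := ⟨hμ.trans_lt ENNReal.one_lt_top⟩
  refine ⟨measurable_charFun.comp (measurable_const_smul c), fun w => ?_,
    fun {V} _ _ _ G hG => ?_⟩
  · refine (norm_charFun_le _).trans ?_
    exact ENNReal.toReal_le_of_le_ofReal zero_le_one (by simpa using hμ)
  calc ∫⁻ x, ‖𝓕 (fun w => MeasureTheory.charFun μ (c • w) • G w) x‖ₑ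
      ≤ ∫⁻ x, ∫⁻ z, ‖𝓕 G (x - (c / (2 * Real.pi)) • z)‖ₑ ∂μ :=
        lintegral_mono fun x => by
          rw [fourier_charFun_smul μ c hG]
          exact enorm_integral_le_lintegral_enorm _
    _ = ∫⁻ z, ∫⁻ x, ‖𝓕 G (x - (c / (2 * Real.pi)) • z)‖ₑ ∂volume ∂μ := by
        refine lintegral_lintegral_swap (Continuous.aemeasurable ?_)
        have := continuous_fourier_of_integrable hG
        exact (this.comp (by fun_prop :
          Continuous fun p : E × E => p.1 - (c / (2 * Real.pi)) • p.2)).enorm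
    _ = ∫⁻ _, (∫⁻ x, ‖𝓕 G x‖ₑ) ∂μ := by
        refine lintegral_congr fun z => ?_
        exact lintegral_sub_right_eq_self (fun x => ‖𝓕 G x‖ₑ) _
    _ ≤ ∫⁻ x, ‖𝓕 G x‖ₑ := by
        rw [lintegral_const]
        exact mul_le_of_le_one_right' hμ

/-- The characteristic function of a compound Poisson law. -/
theorem IsFourierContraction.compoundPoisson (μ : Measure E) [IsFiniteMeasure μ] (c : ℝ) :
    IsFourierContraction
      (fun w => Complex.exp (MeasureTheory.charFun μ (c • w) - μ.real univ)) := by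
  refine of_tendsto (χ := fun n w =>
    (1 + (MeasureTheory.charFun μ (c • w) - μ.real univ) / n) ^ n) ?_
    (fun w => Complex.tendsto_one_add_div_pow_exp _)
  obtain ⟨n₀, hn₀⟩ := exists_nat_gt (μ.real univ)
  filter_upwards [eventually_ge_atTop n₀, eventually_gt_atTop 0] with n hn hn0
  refine pow ?_ n
  have hn0' : (0 : ℝ) < n := by exact_mod_cast hn0
  have hle : μ.real univ / n ≤ 1 := by
    rw [div_le_one hn0']
    exact hn₀.le.trans (by exact_mod_cast hn)
  -- For `n` at least the mass `m` of `μ`, the base `1 + (μ̂ - m)/n` is the characteristic function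
  -- of the probability measure `(1 - m/n) δ₀ + μ/n`.
  obtain ⟨a, ha⟩ : ∃ a : ℝ≥0, (a : ℝ) = 1 - μ.real univ / n := ⟨⟨_, by linarith⟩, rfl⟩
  obtain ⟨b, hb⟩ : ∃ b : ℝ≥0, (b : ℝ) = (n : ℝ)⁻¹ := ⟨⟨_, by positivity⟩, rfl⟩
  have hm : (a • Measure.dirac (0 : E) + b • μ) univ ≤ 1 := by
    have h1 : (a • Measure.dirac (0 : E) + b • μ).real univ = 1 := by
      rw [measureReal_add_apply, measureReal_nnreal_smul_apply, measureReal_nnreal_smul_apply, ha,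
        hb, probReal_univ (μ := Measure.dirac (0 : E))]
      ring
    rw [← ENNReal.ofReal_toReal (measure_ne_top (a • Measure.dirac (0 : E) + b • μ) univ)]
    rw [Measure.real] at h1
    rw [h1, ENNReal.ofReal_one]
  convert IsFourierContraction.charFun hm c using 2 with w
  have hint : ∀ ν : Measure E, IsFiniteMeasure ν →
      Integrable (fun z => Complex.exp (⟪z, c • w⟫ * Complex.I)) ν := fun ν _ =>
    (integrable_const (1 : ℝ)).mono (Continuous.aestronglyMeasurable (by fun_prop))
      (.of_forall fun z => by simp [Complex.norm_exp_ofReal_mul_I])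
  rw [charFun_apply, charFun_apply, integral_add_measure (hint _ inferInstance)
    (hint _ inferInstance), integral_smul_nnreal_measure, integral_smul_nnreal_measure,
    integral_dirac]
  simp only [NNReal.smul_def, ha, hb, inner_zero_left, Complex.ofReal_zero, zero_mul,
    Complex.exp_zero, Complex.real_smul]
  push_cast
  ring

end Multiplier

end LevyGradient

namespace LevyGradient

open scoped FourierTransform RealInnerProductSpace

/-! ### Lévy measures, their symbols, and the contraction property of `exp(-ψ)` -/

section Symbol

variable {d : ℕ}

/-- The integrand `e^{i⟨u,z⟩} - 1 - i⟨u,z⟩ 1_{|z| ≤ 1}` of the Lévy-Khintchine formula. -/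
noncomputable def levyIntegrand (u z : EuclideanSpace ℝ (Fin d)) : ℂ :=
  Complex.exp (Complex.I * (inner ℝ u z : ℝ)) - 1
      - Complex.I * (inner ℝ u z : ℝ) * (Metric.closedBall 0 1).indicator (fun _ => (1 : ℂ)) z

theorem symbol_eq (ν : Measure (EuclideanSpace ℝ (Fin d))) (u : EuclideanSpace ℝ (Fin d)) :
    symbol ν u = -∫ z, levyIntegrand u z ∂ν := rfl

theorem norm_exp_I_mul_sub_one_sub_le (θ : ℝ) :
    ‖Complex.exp (Complex.I * θ) - 1 - Complex.I * θ‖ ≤ 3 * θ ^ 2 := by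
  have hn : ‖Complex.I * (θ : ℂ)‖ = |θ| := by simp
  rcases le_total |θ| 1 with h | h
  · have := Complex.norm_exp_sub_one_sub_id_le (x := Complex.I * θ) (by rwa [hn])
    rw [hn, sq_abs] at this
    nlinarith [sq_nonneg θ]
  · have h1 : ‖Complex.exp (Complex.I * θ) - 1‖ ≤ |θ| := Real.norm_exp_I_mul_ofReal_sub_one_le
    have h2 := norm_sub_le (Complex.exp (Complex.I * θ) - 1) (Complex.I * θ)
    rw [hn] at h2
    nlinarith [sq_abs θ]

theorem levyIntegrand_of_norm_le_one (u : EuclideanSpace ℝ (Fin d))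
    {z : EuclideanSpace ℝ (Fin d)} (hz : ‖z‖ ≤ 1) :
    levyIntegrand u z = Complex.exp (Complex.I * (inner ℝ u z : ℝ)) - 1
      - Complex.I * (inner ℝ u z : ℝ) := by
  rw [levyIntegrand, indicator_of_mem (by simpa using hz), mul_one]

theorem levyIntegrand_of_one_lt_norm (u : EuclideanSpace ℝ (Fin d))
    {z : EuclideanSpace ℝ (Fin d)} (hz : 1 < ‖z‖) :
    levyIntegrand u z = Complex.exp (Complex.I * (inner ℝ u z : ℝ)) - 1 := by
  rw [levyIntegrand, indicator_of_notMem (by simpa using hz), mul_zero, sub_zero]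

theorem norm_levyIntegrand_le (u z : EuclideanSpace ℝ (Fin d)) :
    ‖levyIntegrand u z‖ ≤ (2 + 3 * ‖u‖ ^ 2) * min 1 (‖z‖ ^ 2) := by
  rcases le_or_gt ‖z‖ 1 with h | h
  · rw [levyIntegrand_of_norm_le_one u h, min_eq_right (pow_le_one₀ (norm_nonneg _) h)]
    have h1 : (inner ℝ u z : ℝ) ^ 2 ≤ ‖u‖ ^ 2 * ‖z‖ ^ 2 := by
      rw [← mul_pow, ← sq_abs (inner ℝ u z)]
      exact pow_le_pow_left₀ (abs_nonneg _) (abs_real_inner_le_norm u z) 2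
    nlinarith [norm_exp_I_mul_sub_one_sub_le (inner ℝ u z), sq_nonneg ‖z‖]
  · rw [levyIntegrand_of_one_lt_norm u h, min_eq_left (one_le_pow₀ h.le)]
    have h2 := norm_sub_le (Complex.exp (Complex.I * (inner ℝ u z : ℝ))) 1
    rw [Complex.norm_exp_I_mul_ofReal, norm_one] at h2
    nlinarith [sq_nonneg ‖u‖]

theorem measurable_levyIntegrand (u : EuclideanSpace ℝ (Fin d)) :
    Measurable (levyIntegrand u) := by
  have h : Measurable ((Metric.closedBall (0 : EuclideanSpace ℝ (Fin d)) 1).indicator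
    (fun _ => (1 : ℂ))) := measurable_const.indicator measurableSet_closedBall
  unfold levyIntegrand
  fun_prop

/-- The compensator is purely imaginary, so the truncation does not affect the real part. -/
theorem re_levyIntegrand (u z : EuclideanSpace ℝ (Fin d)) :
    (levyIntegrand u z).re = Real.cos (inner ℝ u z) - 1 := by
  have h (x : ℝ) : (Complex.exp (Complex.I * x)).re = Real.cos x := by
    rw [mul_comm, Complex.exp_ofReal_mul_I_re]
  rcases le_or_gt ‖z‖ 1 with hz | hz
  · simp [levyIntegrand_of_norm_le_one u hz, h]
  · simp [levyIntegrand_of_one_lt_norm u hz, h]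

variable {ν ν' : Measure (EuclideanSpace ℝ (Fin d))}

theorem IsLevyMeasure.integrable_min (hν : IsLevyMeasure ν) :
    Integrable (fun z => min 1 (‖z‖ ^ 2)) ν := by
  refine ⟨Continuous.aestronglyMeasurable (by fun_prop), ?_⟩
  rw [hasFiniteIntegral_iff_ofReal (.of_forall fun z => by positivity)]
  exact hν.lintegral_lt_top

theorem IsLevyMeasure.integrable_levyIntegrand (hν : IsLevyMeasure ν)
    (u : EuclideanSpace ℝ (Fin d)) : Integrable (levyIntegrand u) ν :=
  (hν.integrable_min.const_mul _).mono' (measurable_levyIntegrand u).aestronglyMeasurable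
    (.of_forall (norm_levyIntegrand_le u))

theorem IsLevyMeasure.mono (hν : IsLevyMeasure ν) (h : ν' ≤ ν) : IsLevyMeasure ν' where
  sigmaFinite := have := hν.sigmaFinite; Measure.sigmaFinite_of_le ν h
  zero_singleton := le_antisymm ((h _).trans hν.zero_singleton.le) bot_le
  lintegral_lt_top := (lintegral_mono' h le_rfl).trans_lt hν.lintegral_lt_top

theorem IsLevyMeasure.smul (hν : IsLevyMeasure ν) (c : ℝ≥0) : IsLevyMeasure (c • ν) where
  sigmaFinite := have := hν.sigmaFinite; inferInstance
  zero_singleton := by simp [hν.zero_singleton]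
  lintegral_lt_top := by
    rw [lintegral_smul_measure]
    exact ENNReal.mul_lt_top ENNReal.coe_lt_top hν.lintegral_lt_top

theorem symbol_add (hν : IsLevyMeasure ν) (hν' : IsLevyMeasure ν')
    (u : EuclideanSpace ℝ (Fin d)) : symbol (ν + ν') u = symbol ν u + symbol ν' u := by
  rw [symbol_eq, integral_add_measure (hν.integrable_levyIntegrand u)
    (hν'.integrable_levyIntegrand u), neg_add, symbol_eq, symbol_eq]

theorem symbol_smul (c : ℝ≥0) (u : EuclideanSpace ℝ (Fin d)) :
    symbol (c • ν) u = (c : ℝ) * symbol ν u := by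
  rw [symbol_eq, integral_smul_nnreal_measure, symbol_eq, mul_neg, NNReal.smul_def,
    Complex.real_smul]

theorem IsLevyMeasure.re_symbol (hν : IsLevyMeasure ν) (u : EuclideanSpace ℝ (Fin d)) :
    (symbol ν u).re = ∫ z, (1 - Real.cos (inner ℝ u z)) ∂ν := by
  have h : (∫ z, levyIntegrand u z ∂ν).re = ∫ z, (levyIntegrand u z).re ∂ν :=
    (integral_re (hν.integrable_levyIntegrand u)).symm
  rw [symbol_eq, Complex.neg_re, h, ← integral_neg]
  simp [re_levyIntegrand]

theorem IsLevyMeasure.integrable_one_sub_cos (hν : IsLevyMeasure ν)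
    (u : EuclideanSpace ℝ (Fin d)) : Integrable (fun z => 1 - Real.cos (inner ℝ u z)) ν := by
  have := (hν.integrable_levyIntegrand u).re.neg
  refine this.congr (.of_forall fun z => ?_)
  have := re_levyIntegrand u z
  simp [this]

theorem IsLevyMeasure.isFiniteMeasure_restrict (hν : IsLevyMeasure ν) {ε : ℝ} (hε : 0 < ε) :
    IsFiniteMeasure (ν.restrict {z | ε < ‖z‖}) := by
  constructor
  rw [Measure.restrict_apply_univ]
  refine (measure_mono ?_).trans_lt (hν.integrable_min.measure_ge_lt_top
    (ε := min 1 (ε ^ 2)) (by positivity))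
  intro z hz
  exact min_le_min le_rfl (pow_le_pow_left₀ hε.le (le_of_lt hz) 2)

/-- For a finite measure the compensator integrates to a deterministic drift. The exponential is
then a compound Poisson factor times the characteristic function of the Dirac mass at `-∫_B z dν`.
-/
theorem isFourierContraction_exp_neg_symbol_of_isFiniteMeasure [IsFiniteMeasure ν]
    (c : ℝ) : IsFourierContraction (fun w => Complex.exp (-symbol ν (c • w))) := by
  set B : Set (EuclideanSpace ℝ (Fin d)) := Metric.closedBall 0 1
  have hid : IntegrableOn (fun z : EuclideanSpace ℝ (Fin d) => z) B ν :=
    Integrable.mono' (integrable_const (1 : ℝ)) (by fun_prop)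
      ((ae_restrict_iff' measurableSet_closedBall).2 (.of_forall fun z hz => by
        simpa [B] using hz))
  have hdrift : IsFourierContraction (fun w => charFun (Measure.dirac (-∫ z in B, z ∂ν)) (c • w)) :=
    .charFun (by simp) c
  convert (IsFourierContraction.compoundPoisson ν c).mul hdrift using 2 with w
  have h1 : Integrable (fun z => Complex.exp (Complex.I * (inner ℝ (c • w) z : ℝ))) ν :=
    (integrable_const (1 : ℝ)).mono (Continuous.aestronglyMeasurable (by fun_prop))
      (.of_forall fun z => by simp [Complex.norm_exp_I_mul_ofReal])
  have h2 : IntegrableOn (fun z => Complex.I * (inner ℝ (c • w) z : ℝ)) B ν :=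
    (hid.const_inner (c • w)).ofReal.const_mul _
  have h3 : (fun z => Complex.I * (inner ℝ (c • w) z : ℝ) * B.indicator (fun _ => (1 : ℂ)) z)
      = B.indicator (fun z => Complex.I * (inner ℝ (c • w) z : ℝ)) := by
    ext z
    by_cases hz : z ∈ B <;> simp [hz]
  have h4 : ∫ z in B, Complex.I * ((inner ℝ (c • w) z : ℝ) : ℂ) ∂ν
      = Complex.I * ((inner ℝ (c • w) (∫ z in B, z ∂ν) : ℝ) : ℂ) := by
    rw [integral_const_mul, integral_complex_ofReal, integral_inner hid]
  have h5 : Integrable (fun z => Complex.exp (Complex.I * (inner ℝ (c • w) z : ℝ)) - 1) ν :=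
    h1.sub (integrable_const _)
  have h6 : ∫ z, Complex.exp (Complex.I * (inner ℝ (c • w) z : ℝ)) ∂ν = charFun ν (c • w) := by
    simp only [charFun_apply, mul_comm Complex.I, real_inner_comm]
  have h7 : Integrable (fun z => Complex.I * (inner ℝ (c • w) z : ℝ)
      * B.indicator (fun _ => (1 : ℂ)) z) ν := by
    rw [h3]
    exact h2.integrable_indicator measurableSet_closedBall
  rw [charFun_dirac, ← Complex.exp_add, symbol, neg_neg, integral_sub h5 h7,
    integral_sub h1 (integrable_const _), h3, integral_indicator measurableSet_closedBall, h4, h6,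
    integral_const, inner_neg_left, real_inner_comm]
  simp only [Complex.real_smul, mul_one, Complex.ofReal_neg]
  ring_nf

/-- The characteristic exponent of a Lévy process with jump measure `ν` gives a contraction. -/
theorem IsLevyMeasure.isFourierContraction_exp_neg_symbol (hν : IsLevyMeasure ν) (c : ℝ) :
    IsFourierContraction (fun w => Complex.exp (-symbol ν (c • w))) := by
  -- Jumps of size at most `1/(n+1)` are removed, which leaves a finite measure; the symbols
  -- converge by dominated convergence.
  set A : ℕ → Set (EuclideanSpace ℝ (Fin d)) := fun n => {z | 1 / ((n : ℝ) + 1) < ‖z‖}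
  have hA : ∀ n, MeasurableSet (A n) := fun n => measurableSet_lt measurable_const measurable_norm
  refine .of_tendsto (χ := fun n w => Complex.exp (-symbol (ν.restrict (A n)) (c • w)))
    (.of_forall fun n => ?_) (fun w => ?_)
  · have := hν.isFiniteMeasure_restrict (ε := 1 / ((n : ℝ) + 1)) (by positivity)
    exact isFourierContraction_exp_neg_symbol_of_isFiniteMeasure c
  · refine (Complex.continuous_exp.tendsto _).comp (Tendsto.neg ?_)
    simp only [symbol_eq]
    refine Tendsto.neg ?_
    simp only [← integral_indicator (hA _)]
    have hi := hν.integrable_levyIntegrand (c • w)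
    refine tendsto_integral_of_dominated_convergence (fun z => ‖levyIntegrand (c • w) z‖)
      (fun n => (hi.indicator (hA n)).1) hi.norm
      (fun n => .of_forall fun z => norm_indicator_le_norm_self _ _)
      (.of_forall fun z => ?_)
    -- The origin lies in none of the sets `A n`, but the integrand vanishes there.
    rcases eq_or_ne z 0 with rfl | hz
    · have : levyIntegrand (c • w) 0 = 0 := by simp [levyIntegrand]
      simp [indicator_apply, this]
    · refine tendsto_const_nhds.congr' ?_
      have := tendsto_one_div_add_atTop_nhds_zero_nat (𝕜 := ℝ)
      filter_upwards [this.eventually (gt_mem_nhds (norm_pos_iff.2 hz))] with n hn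
      exact (indicator_of_mem (show z ∈ A n from hn) _).symm

end Symbol

end LevyGradient

namespace LevyGradient

open scoped FourierTransform RealInnerProductSpace ContDiff

/-! ### Derivatives of the symbol of a measure on the unit ball -/

section Smoothness

variable {d : ℕ}

/-- The real linear functional `w ↦ 2π⟨y, w⟩` with values in `ℂ`. -/
noncomputable def twoPiInner (y : EuclideanSpace ℝ (Fin d)) : EuclideanSpace ℝ (Fin d) →L[ℝ] ℂ :=
  (2 * Real.pi) • Complex.ofRealCLM.comp (innerSL ℝ y)

theorem twoPiInner_apply (y w : EuclideanSpace ℝ (Fin d)) :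
    twoPiInner y w = ((inner ℝ ((2 * Real.pi) • w) y : ℝ) : ℂ) := by
  simp [twoPiInner, inner_smul_left, real_inner_comm]

theorem norm_twoPiInner_le (y : EuclideanSpace ℝ (Fin d)) :
    ‖twoPiInner y‖ ≤ 2 * Real.pi * ‖y‖ := by
  refine ContinuousLinearMap.opNorm_le_bound _ (by positivity) fun w => ?_
  rw [twoPiInner_apply, Complex.norm_real, inner_smul_left, norm_mul]
  simp only [conj_trivial, norm_mul, Real.norm_eq_abs, abs_of_pos Real.pi_pos, abs_two]
  have := abs_real_inner_le_norm w y
  have hpi := Real.pi_pos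
  nlinarith

@[fun_prop]
theorem continuous_twoPiInner : Continuous (twoPiInner (d := d)) := by
  unfold twoPiInner
  fun_prop

theorem hasFDerivAt_exp_twoPiInner (y w : EuclideanSpace ℝ (Fin d)) :
    HasFDerivAt (fun w => Complex.exp (Complex.I * twoPiInner y w))
      ((Complex.exp (Complex.I * twoPiInner y w) * Complex.I) • twoPiInner y) w := by
  have h := (((twoPiInner y).hasFDerivAt (x := w)).const_mul Complex.I).cexp
  rwa [smul_smul] at h

theorem norm_exp_twoPiInner (y w : EuclideanSpace ℝ (Fin d)) :
    ‖Complex.exp (Complex.I * twoPiInner y w)‖ = 1 := by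
  rw [twoPiInner_apply, Complex.norm_exp_I_mul_ofReal]

theorem norm_exp_twoPiInner_sub_one_le (y w : EuclideanSpace ℝ (Fin d)) :
    ‖Complex.exp (Complex.I * twoPiInner y w) - 1‖ ≤ 2 * Real.pi * ‖y‖ * ‖w‖ := by
  have h1 : ‖Complex.exp (Complex.I * twoPiInner y w) - 1‖ ≤ ‖twoPiInner y w‖ := by
    rw [twoPiInner_apply, Complex.norm_real]
    exact Real.norm_exp_I_mul_ofReal_sub_one_le
  exact h1.trans (((twoPiInner y).le_opNorm w).trans (by gcongr; exact norm_twoPiInner_le y))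

/-- The bilinear form `(v, w) ↦ (2π)² ⟨y, v⟩ ⟨y, w⟩` with values in `ℂ`. -/
noncomputable def twoPiInnerSq (y : EuclideanSpace ℝ (Fin d)) :
    EuclideanSpace ℝ (Fin d) →L[ℝ] EuclideanSpace ℝ (Fin d) →L[ℝ] ℂ :=
  ContinuousLinearMap.smulRight ((2 * Real.pi) • innerSL ℝ y : _ →L[ℝ] ℝ) (twoPiInner y)

theorem twoPiInnerSq_apply (y v w : EuclideanSpace ℝ (Fin d)) :
    twoPiInnerSq y v w = twoPiInner y v * twoPiInner y w := by
  simp [twoPiInnerSq, twoPiInner]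

@[fun_prop]
theorem continuous_twoPiInnerSq : Continuous (twoPiInnerSq (d := d)) := by
  have h : Continuous fun y : EuclideanSpace ℝ (Fin d) =>
      ContinuousLinearMap.smulRightL ℝ (EuclideanSpace ℝ (Fin d))
        (EuclideanSpace ℝ (Fin d) →L[ℝ] ℂ) ((2 * Real.pi) • innerSL ℝ y) (twoPiInner y) := by
    fun_prop
  exact h

/-- The derivative of the rescaled symbol of a measure supported in the unit ball. -/
noncomputable def symbolDeriv (N : Measure (EuclideanSpace ℝ (Fin d)))
    (w : EuclideanSpace ℝ (Fin d)) : EuclideanSpace ℝ (Fin d) →L[ℝ] ℂ :=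
  -∫ y, ((Complex.exp (Complex.I * twoPiInner y w) - 1) * Complex.I) • twoPiInner y ∂N

/-- The second derivative of the rescaled symbol, as a Fourier integral. -/
noncomputable def symbolDeriv₂ (N : Measure (EuclideanSpace ℝ (Fin d))) :
    EuclideanSpace ℝ (Fin d) →
      EuclideanSpace ℝ (Fin d) →L[ℝ] EuclideanSpace ℝ (Fin d) →L[ℝ] ℂ :=
  VectorFourier.fourierIntegral Real.fourierChar N (-innerSL ℝ).toLinearMap₁₂
    (fun y => twoPiInnerSq y)

variable {N : Measure (EuclideanSpace ℝ (Fin d))}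

/-- The compensator leaves `e^{iθ} - 1` in the first derivative, which supplies a second factor
`‖y‖`; a finite second moment then suffices. The price is linear growth in `w`. -/
theorem norm_symbolDeriv_integrand_le (y w : EuclideanSpace ℝ (Fin d)) :
    ‖((Complex.exp (Complex.I * twoPiInner y w) - 1) * Complex.I) • twoPiInner y‖
      ≤ (2 * Real.pi) ^ 2 * ‖w‖ * ‖y‖ ^ 2 := by
  rw [norm_smul, norm_mul, Complex.norm_I, mul_one]
  calc _ ≤ (2 * Real.pi * ‖y‖ * ‖w‖) * (2 * Real.pi * ‖y‖) := by
        gcongr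
        exacts [norm_exp_twoPiInner_sub_one_le y w, norm_twoPiInner_le y]
    _ = _ := by ring

theorem norm_twoPiInnerSq_le (y : EuclideanSpace ℝ (Fin d)) :
    ‖twoPiInnerSq y‖ ≤ (2 * Real.pi) ^ 2 * ‖y‖ ^ 2 := by
  refine ContinuousLinearMap.opNorm_le_bound₂ _ (by positivity) fun v w => ?_
  rw [twoPiInnerSq_apply, norm_mul]
  have h := fun u => ((twoPiInner y).le_opNorm u).trans
    (mul_le_mul_of_nonneg_right (norm_twoPiInner_le y) (norm_nonneg u))
  calc _ ≤ (2 * Real.pi * ‖y‖ * ‖v‖) * (2 * Real.pi * ‖y‖ * ‖w‖) := by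
        gcongr <;> exact h _
    _ = _ := by ring

/-- On the unit ball the truncation is identically one, so the integrand is smooth in `w` and can be
differentiated under the integral. -/
theorem hasFDerivAt_symbol (h1 : ∀ᵐ y ∂N, ‖y‖ ≤ 1) (h2 : Integrable (fun y => ‖y‖ ^ 2) N)
    (w : EuclideanSpace ℝ (Fin d)) :
    HasFDerivAt (fun w => symbol N ((2 * Real.pi) • w)) (symbolDeriv N w) w := by
  have hs : ∀ w, ∫ y, levyIntegrand ((2 * Real.pi) • w) y ∂N
      = ∫ y, (Complex.exp (Complex.I * twoPiInner y w) - 1 - Complex.I * twoPiInner y w) ∂N :=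
    fun w => integral_congr_ae (by
      filter_upwards [h1] with y hy
      rw [levyIntegrand_of_norm_le_one _ hy, twoPiInner_apply])
  simp only [symbol_eq, hs]
  refine HasFDerivAt.neg ?_
  refine hasFDerivAt_integral_of_dominated_of_fderiv_le (𝕜 := ℝ) (μ := N)
    (F := fun w y =>
      Complex.exp (Complex.I * twoPiInner y w) - 1 - Complex.I * twoPiInner y w)
    (F' := fun w y => ((Complex.exp (Complex.I * twoPiInner y w) - 1) * Complex.I) • twoPiInner y)
    (Metric.ball_mem_nhds w one_pos)
    (bound := fun y => (2 * Real.pi) ^ 2 * (‖w‖ + 1) * ‖y‖ ^ 2)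
    (.of_forall fun x => ?_) ?_ ?_
    (.of_forall fun y x hx => ?_) (h2.const_mul _) (.of_forall fun y x _ => ?_)
  · refine Continuous.aestronglyMeasurable ?_
    simp only [twoPiInner_apply]
    fun_prop
  · refine (h2.const_mul (3 * (2 * Real.pi * ‖w‖) ^ 2)).mono' ?_ (.of_forall fun y => ?_)
    · refine Continuous.aestronglyMeasurable ?_
      simp only [twoPiInner_apply]
      fun_prop
    · rw [twoPiInner_apply]
      refine (norm_exp_I_mul_sub_one_sub_le _).trans ?_
      have h3 := abs_real_inner_le_norm ((2 * Real.pi) • w) y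
      rw [norm_smul, Real.norm_of_nonneg (by positivity)] at h3
      have h4 := pow_le_pow_left₀ (abs_nonneg _) h3 2
      rw [sq_abs] at h4
      nlinarith
  · refine Continuous.aestronglyMeasurable ?_
    have : Continuous fun y => twoPiInner y w := by simp only [twoPiInner_apply]; fun_prop
    fun_prop
  · refine (norm_symbolDeriv_integrand_le y x).trans ?_
    have : ‖x‖ ≤ ‖w‖ + 1 := by
      have h5 := norm_le_norm_add_norm_sub' x w
      rw [Metric.mem_ball, dist_eq_norm] at hx
      linarith
    gcongr
  · have h6 := ((hasFDerivAt_exp_twoPiInner y x).sub_const 1).sub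
      ((twoPiInner y).hasFDerivAt.const_mul Complex.I)
    rwa [← sub_smul, ← sub_one_mul] at h6

/-- The second differentiation removes the constant `-1`. What remains is the Fourier integral of a
quadratic form in `y`, so every higher derivative follows from the general theory of Fourier
integrals. -/
theorem hasFDerivAt_symbolDeriv (h2 : Integrable (fun y => ‖y‖ ^ 2) N)
    (w : EuclideanSpace ℝ (Fin d)) :
    HasFDerivAt (symbolDeriv N) (symbolDeriv₂ N w) w := by
  have hs : symbolDeriv₂ N w = -∫ y, (-Complex.exp (Complex.I * twoPiInner y w)) •
      twoPiInnerSq y ∂N := by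
    rw [← integral_neg]
    refine integral_congr_ae (.of_forall fun y => ?_)
    have h3 : ((Real.fourierChar (-(-innerSL ℝ).toLinearMap₁₂ y w) : Circle) : ℂ)
        = - -Complex.exp (Complex.I * twoPiInner y w) := by
      rw [neg_neg, Real.fourierChar_apply, twoPiInner_apply, inner_smul_left]
      congr 1
      simp [real_inner_comm]
      ring
    beta_reduce
    rw [Circle.smul_def, h3]
    exact neg_smul (-Complex.exp (Complex.I * twoPiInner y w)) (twoPiInnerSq y)
  rw [hs]
  refine HasFDerivAt.neg ?_
  have hc : ∀ x : EuclideanSpace ℝ (Fin d), Continuous fun y => twoPiInner y x := fun x => by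
    simp only [twoPiInner_apply]; fun_prop
  refine hasFDerivAt_integral_of_dominated_of_fderiv_le (𝕜 := ℝ) (μ := N)
    (F := fun w y => ((Complex.exp (Complex.I * twoPiInner y w) - 1) * Complex.I) • twoPiInner y)
    (F' := fun w y => (-Complex.exp (Complex.I * twoPiInner y w)) • twoPiInnerSq y)
    (Metric.ball_mem_nhds w one_pos)
    (bound := fun y => (2 * Real.pi) ^ 2 * ‖y‖ ^ 2)
    (.of_forall fun x => ?_) ?_ ?_
    (.of_forall fun y x hx => ?_) (h2.const_mul _) (.of_forall fun y x _ => ?_)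
  · have := hc x
    exact Continuous.aestronglyMeasurable (by fun_prop)
  · refine (h2.const_mul ((2 * Real.pi) ^ 2 * ‖w‖)).mono' ?_
      (.of_forall fun y => norm_symbolDeriv_integrand_le y w)
    have := hc w
    exact Continuous.aestronglyMeasurable (by fun_prop)
  · have := hc w
    exact Continuous.aestronglyMeasurable (by fun_prop)
  · rw [norm_smul, norm_neg, norm_exp_twoPiInner, one_mul]
    exact norm_twoPiInnerSq_le y
  · have h6 := (((hasFDerivAt_exp_twoPiInner y x).sub_const 1).mul_const Complex.I).smul_const
      (twoPiInner y)
    convert h6 using 1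
    ext v u
    simp [twoPiInnerSq_apply]
    linear_combination (Complex.exp (Complex.I * (twoPiInner y) x) * (twoPiInner y) v
      * (twoPiInner y) u) * -Complex.I_sq

/-- Since `‖y‖ ≤ 1` almost everywhere, the second moment controls all higher moments; this gives
smoothness to every order. -/
theorem integrable_pow_mul_norm_twoPiInnerSq (h1 : ∀ᵐ y ∂N, ‖y‖ ≤ 1)
    (h2 : Integrable (fun y => ‖y‖ ^ 2) N) (n : ℕ) :
    Integrable (fun y => ‖y‖ ^ n * ‖twoPiInnerSq y‖) N := by
  have hq : Continuous fun y : EuclideanSpace ℝ (Fin d) => ‖twoPiInnerSq y‖ :=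
    Continuous.norm (E := EuclideanSpace ℝ (Fin d) →L[ℝ] EuclideanSpace ℝ (Fin d) →L[ℝ] ℂ)
      continuous_twoPiInnerSq
  have hc : Continuous fun y : EuclideanSpace ℝ (Fin d) => ‖y‖ ^ n * ‖twoPiInnerSq y‖ := by
    fun_prop
  refine (h2.const_mul ((2 * Real.pi) ^ 2)).mono' hc.aestronglyMeasurable ?_
  · filter_upwards [h1] with y hy
    rw [Real.norm_of_nonneg (by positivity)]
    exact (mul_le_of_le_one_left (norm_nonneg (twoPiInnerSq y))
      (pow_le_one₀ (norm_nonneg _) hy)).trans (norm_twoPiInnerSq_le y)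

theorem contDiff_symbol (h1 : ∀ᵐ y ∂N, ‖y‖ ≤ 1) (h2 : Integrable (fun y => ‖y‖ ^ 2) N) :
    ContDiff ℝ ∞ (fun w => symbol N ((2 * Real.pi) • w)) := by
  have e1 : fderiv ℝ (fun w => symbol N ((2 * Real.pi) • w)) = symbolDeriv N :=
    funext fun w => (hasFDerivAt_symbol h1 h2 w).fderiv
  have e2 : fderiv ℝ (symbolDeriv N) = symbolDeriv₂ N :=
    funext fun w => (hasFDerivAt_symbolDeriv h2 w).fderiv
  rw [contDiff_infty_iff_fderiv, e1, contDiff_infty_iff_fderiv, e2]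
  refine ⟨fun w => (hasFDerivAt_symbol h1 h2 w).differentiableAt,
    fun w => (hasFDerivAt_symbolDeriv h2 w).differentiableAt, ?_⟩
  exact VectorFourier.contDiff_fourierIntegral (N := ⊤) _ fun n _ =>
    integrable_pow_mul_norm_twoPiInnerSq h1 h2 n

theorem norm_iteratedFDeriv_symbolDeriv₂_le (h1 : ∀ᵐ y ∂N, ‖y‖ ≤ 1)
    (h2 : Integrable (fun y => ‖y‖ ^ 2) N) (m : ℕ) (w : EuclideanSpace ℝ (Fin d)) :
    ‖iteratedFDeriv ℝ m (symbolDeriv₂ N) w‖ ≤ (2 * Real.pi) ^ (m + 2) * ∫ y, ‖y‖ ^ 2 ∂N := by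
  have hm : AEStronglyMeasurable (fun y : EuclideanSpace ℝ (Fin d) => twoPiInnerSq y) N :=
    continuous_twoPiInnerSq.aestronglyMeasurable
  have hL : ‖-innerSL ℝ (E := EuclideanSpace ℝ (Fin d))‖ ≤ 1 := by
    refine ContinuousLinearMap.opNorm_le_bound _ zero_le_one fun x => ?_
    simp
  rw [symbolDeriv₂, VectorFourier.iteratedFDeriv_fourierIntegral (N := ⊤) _
    (fun n _ => integrable_pow_mul_norm_twoPiInnerSq h1 h2 n) hm le_top, ← integral_const_mul]
  refine (VectorFourier.norm_fourierIntegral_le_integral_norm _ _ _ _ _).trans ?_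
  refine integral_mono_of_nonneg (.of_forall fun y => norm_nonneg _) (h2.const_mul _) ?_
  filter_upwards [h1] with y hy
  refine (VectorFourier.norm_fourierPowSMulRight_le _ _ _ _).trans ?_
  calc _ ≤ (2 * Real.pi * 1) ^ m * 1 ^ m * ((2 * Real.pi) ^ 2 * ‖y‖ ^ 2) := by
        gcongr
        exact norm_twoPiInnerSq_le y
    _ = _ := by ring

/-- The first derivative grows linearly in `w`, and the higher ones are bounded. Both are weakened
to the common form `D^n`, which the estimate `norm_iteratedFDeriv_comp_le` for composite functions
requires. -/
theorem norm_iteratedFDeriv_symbol_le (h1 : ∀ᵐ y ∂N, ‖y‖ ≤ 1)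
    (h2 : Integrable (fun y => ‖y‖ ^ 2) N) {C : ℝ} (hC : ∫ y, ‖y‖ ^ 2 ∂N ≤ C) {n : ℕ} (hn : 1 ≤ n)
    (w : EuclideanSpace ℝ (Fin d)) :
    ‖iteratedFDeriv ℝ n (fun w => symbol N ((2 * Real.pi) • w)) w‖
      ≤ ((2 * Real.pi) ^ 2 * (1 + C) * (1 + ‖w‖)) ^ n := by
  have hC0 : 0 ≤ C := le_trans (integral_nonneg fun y => by positivity) hC
  have hpi : (1 : ℝ) ≤ 2 * Real.pi := by linarith [Real.pi_gt_three]
  have e1 : fderiv ℝ (fun w => symbol N ((2 * Real.pi) • w)) = symbolDeriv N :=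
    funext fun w => (hasFDerivAt_symbol h1 h2 w).fderiv
  have e2 : fderiv ℝ (symbolDeriv N) = symbolDeriv₂ N :=
    funext fun w => (hasFDerivAt_symbolDeriv h2 w).fderiv
  obtain ⟨m, rfl⟩ : ∃ m, n = m + 1 := ⟨n - 1, by omega⟩
  rw [← norm_iteratedFDeriv_fderiv, e1]
  rcases m with _ | m
  · rw [norm_iteratedFDeriv_zero, symbolDeriv, norm_neg, zero_add, pow_one]
    calc _ ≤ ∫ y, (2 * Real.pi) ^ 2 * ‖w‖ * ‖y‖ ^ 2 ∂N :=
          norm_integral_le_of_norm_le (h2.const_mul _)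
            (.of_forall fun y => norm_symbolDeriv_integrand_le y w)
      _ = (2 * Real.pi) ^ 2 * ‖w‖ * ∫ y, ‖y‖ ^ 2 ∂N := integral_const_mul _ _
      _ ≤ (2 * Real.pi) ^ 2 * (1 + ‖w‖) * (1 + C) := by gcongr <;> linarith
      _ = _ := by ring
  · rw [← norm_iteratedFDeriv_fderiv, e2]
    calc _ ≤ (2 * Real.pi) ^ (m + 2) * ∫ y, ‖y‖ ^ 2 ∂N :=
          norm_iteratedFDeriv_symbolDeriv₂_le h1 h2 m w
        _ ≤ (2 * Real.pi) ^ (2 * (m + 2)) * (1 + C) ^ (m + 2) * 1 ^ (m + 2) := by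
            rw [one_pow, mul_one]
            gcongr ?_ * ?_
            · exact pow_le_pow_right₀ hpi (by omega)
            · exact hC.trans <| (by linarith : C ≤ 1 + C).trans (le_self_pow₀ (by linarith) (by omega))
        _ ≤ (2 * Real.pi) ^ (2 * (m + 2)) * (1 + C) ^ (m + 2) * (1 + ‖w‖) ^ (m + 2) := by
            gcongr
            linarith [norm_nonneg w]
        _ = _ := by rw [pow_mul, ← mul_pow, ← mul_pow]

theorem norm_iteratedFDeriv_cexp_le (n : ℕ) (z : ℂ) :
    ‖iteratedFDeriv ℝ n Complex.exp z‖ ≤ ‖Complex.exp z‖ := by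
  induction n generalizing z with
  | zero => simp
  | succ n ih =>
    have h : fderiv ℝ Complex.exp = fun z => ContinuousLinearMap.mul ℝ ℂ (Complex.exp z) := by
      ext1 z
      have := (Complex.hasDerivAt_exp z).hasFDerivAt.restrictScalars ℝ
      rw [this.fderiv]
      ext v
      simp [mul_comm]
    rw [← norm_iteratedFDeriv_fderiv, h]
    have h3 := (ContinuousLinearMap.mul ℝ ℂ).norm_iteratedFDeriv_comp_left
      (f := Complex.exp) (x := z) (n := n) (N := n) Complex.contDiff_exp.contDiffAt le_rfl
    refine h3.trans ?_
    refine (mul_le_of_le_one_left (norm_nonneg _) ?_).trans (ih z)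
    exact ContinuousLinearMap.opNorm_mul_le ℝ ℂ

theorem contDiff_exp_neg_symbol (h1 : ∀ᵐ y ∂N, ‖y‖ ≤ 1)
    (h2 : Integrable (fun y => ‖y‖ ^ 2) N) :
    ContDiff ℝ ∞ (fun w => Complex.exp (-symbol N ((2 * Real.pi) • w))) :=
  (contDiff_symbol h1 h2).neg.cexp

/-- Every derivative of `exp` at a point has norm at most `|exp|` there, so the decay of `exp(-Re
ψ)` survives differentiation at a polynomial cost. -/
theorem norm_iteratedFDeriv_exp_neg_symbol_le (h1 : ∀ᵐ y ∂N, ‖y‖ ≤ 1)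
    (h2 : Integrable (fun y => ‖y‖ ^ 2) N) {C : ℝ} (hC : ∫ y, ‖y‖ ^ 2 ∂N ≤ C) (n : ℕ)
    (w : EuclideanSpace ℝ (Fin d)) :
    ‖iteratedFDeriv ℝ n (fun w => Complex.exp (-symbol N ((2 * Real.pi) • w))) w‖
      ≤ n.factorial * Real.exp (-(symbol N ((2 * Real.pi) • w)).re)
        * ((2 * Real.pi) ^ 2 * (1 + C) * (1 + ‖w‖)) ^ n := by
  refine norm_iteratedFDeriv_comp_le (N := ∞) (g := Complex.exp)
    (f := fun w => -symbol N ((2 * Real.pi) • w)) Complex.contDiff_exp (contDiff_symbol h1 h2).neg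
    (by exact_mod_cast le_top) w (fun i _ => ?_) (fun i hi _ => ?_)
  · refine (norm_iteratedFDeriv_cexp_le i _).trans ?_
    rw [Complex.norm_exp, Complex.neg_re]
  · have : (fun w => -symbol N ((2 * Real.pi) • w)) = -fun w => symbol N ((2 * Real.pi) • w) := rfl
    rw [this, iteratedFDeriv_neg, Pi.neg_apply, norm_neg]
    exact norm_iteratedFDeriv_symbol_le h1 h2 hC hi w

end Smoothness

end LevyGradient

namespace LevyGradient

open scoped FourierTransform RealInnerProductSpace ContDiff

/-! ### Uniform `L¹` bounds for the Fourier transform of `exp(-ψ_N)` and its gradient -/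

section FourierDecay

variable {d : ℕ}

/-- If `1 + d` derivatives of `f`, with weight `1 + |v|`, are dominated by an integrable function
`h`, then the Fourier transform of `f` and its derivative decay like `|x|^{-(d+1)}`. -/
theorem norm_iteratedFDeriv_fourier_le_of_dominated {f : EuclideanSpace ℝ (Fin d) → ℂ}
    (hf : ContDiff ℝ ∞ f) {h : EuclideanSpace ℝ (Fin d) → ℝ} (hh : Integrable h)
    (hfh : ∀ n ≤ d + 1, ∀ v, (1 + ‖v‖) * ‖iteratedFDeriv ℝ n f v‖ ≤ h v) {k : ℕ} (hk : k ≤ 1)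
    (x : EuclideanSpace ℝ (Fin d)) :
    ‖iteratedFDeriv ℝ k (𝓕 f) x‖
      ≤ (2 ^ (d + 2) * (2 * Real.pi * 4 ^ (d + 1) * (2 * (d + 2)) * ∫ v, h v))
        * (1 + ‖x‖) ^ (-((d : ℝ) + 1)) := by
  set A : ℝ := 2 * Real.pi * 4 ^ (d + 1) * (2 * (d + 2)) * ∫ v, h v with hA
  have hpi : (1 : ℝ) ≤ 2 * Real.pi := by linarith [Real.pi_gt_three]
  have hdom : ∀ k n : ℕ, k ≤ 1 → n ≤ d + 1 → ∀ v,
      ‖v‖ ^ k * ‖iteratedFDeriv ℝ n f v‖ ≤ h v := fun k n hk hn v => by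
    refine le_trans ?_ (hfh n hn v)
    gcongr
    interval_cases k
    · simp
    · simp
  have hh0 : ∀ v, 0 ≤ h v := fun v => le_trans (by positivity) (hdom 0 0 (by simp) (by simp) v)
  have hI0 : 0 ≤ ∫ v, h v := integral_nonneg hh0
  have hint : ∀ k n : ℕ, (k : ℕ∞) ≤ (1 : ℕ) → (n : ℕ∞) ≤ (d + 1 : ℕ) →
      Integrable (fun v => ‖v‖ ^ k * ‖iteratedFDeriv ℝ n f v‖) := fun k n hk hn => by
    have hc : Continuous (iteratedFDeriv ℝ n f) :=
      hf.continuous_iteratedFDeriv (by exact_mod_cast le_top)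
    refine hh.mono' (Continuous.aestronglyMeasurable (by fun_prop)) (.of_forall fun v => ?_)
    rw [Real.norm_of_nonneg (by positivity)]
    exact hdom k n (by exact_mod_cast hk) (by exact_mod_cast hn) v
  have key : ∀ n ≤ d + 1, ‖x‖ ^ n * ‖iteratedFDeriv ℝ k (𝓕 f) x‖ ≤ A := fun n hn => by
    have h1 := Real.pow_mul_norm_iteratedFDeriv_fourier_le (K := (1 : ℕ)) (N := (d + 1 : ℕ))
      (hf.of_le (by exact_mod_cast le_top)) hint (k := k) (n := n) (by exact_mod_cast hk)
      (by exact_mod_cast hn) x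
    refine h1.trans ?_
    -- With `k ≤ 1` and `n ≤ d + 1` there are at most `2(d + 2)` index pairs, each contributing at
    -- most `∫ h`.
    have h2 : ∑ p ∈ Finset.range (k + 1) ×ˢ Finset.range (n + 1),
        ∫ v, ‖v‖ ^ p.1 * ‖iteratedFDeriv ℝ p.2 f v‖ ≤ 2 * (d + 2) * ∫ v, h v := by
      have h3 : ∀ p ∈ Finset.range (k + 1) ×ˢ Finset.range (n + 1),
          ∫ v, ‖v‖ ^ p.1 * ‖iteratedFDeriv ℝ p.2 f v‖ ≤ ∫ v, h v := fun p hp => by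
        simp only [Finset.mem_product, Finset.mem_range] at hp
        exact integral_mono (hint _ _ (by exact_mod_cast (by omega)) (by exact_mod_cast (by omega)))
          hh (hdom _ _ (by omega) (by omega))
      refine (Finset.sum_le_card_nsmul _ _ _ h3).trans ?_
      rw [nsmul_eq_mul]
      gcongr
      rw [Finset.card_product, Finset.card_range, Finset.card_range]
      have : (k + 1) * (n + 1) ≤ 2 * (d + 2) := Nat.mul_le_mul (by omega) (by omega)
      exact_mod_cast this
    have h4 : (2 * Real.pi) ^ k ≤ 2 * Real.pi := by
      simpa using pow_le_pow_right₀ hpi hk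
    have h5 : (2 * (k : ℝ) + 2) ^ n ≤ 4 ^ (d + 1) := by
      have : (2 * (k : ℝ) + 2) ≤ 4 := by
        have : (k : ℝ) ≤ 1 := by exact_mod_cast hk
        linarith
      exact (pow_le_pow_left₀ (by positivity) this n).trans
        (pow_le_pow_right₀ (by norm_num) hn)
    calc _ ≤ (2 * Real.pi) * 4 ^ (d + 1) * (2 * (d + 2) * ∫ v, h v) := by gcongr
      _ = A := by rw [hA]; ring
  -- The cases `n = 0` and `n = d + 1` combine through `(1 + |x|)^{d+1} ≤ 2^d (1 + |x|^{d+1})`. The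
  -- exponent `d + 1` exceeds the dimension, so the resulting decay is integrable.
  have h6 : (1 + ‖x‖) ^ (d + 1) * ‖iteratedFDeriv ℝ k (𝓕 f) x‖ ≤ 2 ^ (d + 2) * A := by
    have h7 := add_pow_le (zero_le_one) (norm_nonneg x) (d + 1)
    simp only [one_pow, add_tsub_cancel_right] at h7
    have h8 := key 0 (by omega)
    rw [pow_zero, one_mul] at h8
    have h9 := key (d + 1) le_rfl
    calc _ ≤ (2 ^ d * (1 + ‖x‖ ^ (d + 1))) * ‖iteratedFDeriv ℝ k (𝓕 f) x‖ := by gcongr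
      _ = 2 ^ d * (‖iteratedFDeriv ℝ k (𝓕 f) x‖
          + ‖x‖ ^ (d + 1) * ‖iteratedFDeriv ℝ k (𝓕 f) x‖) := by ring
      _ ≤ 2 ^ d * (A + A) := by gcongr
      _ ≤ 2 ^ (d + 2) * A := by
        have : 0 ≤ A := by positivity
        rw [pow_add]
        nlinarith [pow_pos (two_pos (α := ℝ)) d, mul_nonneg (pow_pos (two_pos (α := ℝ)) d).le this]
  have h10 : (0 : ℝ) < (1 + ‖x‖) ^ (d + 1) := by positivity
  have h11 : (1 + ‖x‖) ^ (-((d : ℝ) + 1)) = ((1 + ‖x‖) ^ (d + 1))⁻¹ := by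
    rw [Real.rpow_neg (by positivity), ← Real.rpow_natCast]
    push_cast
    rfl
  rw [h11, ← div_eq_mul_inv, le_div_iff₀ h10, mul_comm]
  exact h6

theorem exists_one_add_pow_mul_exp_le {α c : ℝ} (hα : 0 < α) (hc : 0 < c) (m : ℕ) :
    ∃ A : ℝ, 0 ≤ A ∧ ∀ s : ℝ, 0 ≤ s → (1 + s) ^ m * Real.exp (-(c * s ^ α)) ≤ A := by
  -- With `jα ≥ m`, the term of order `j` in the series of `exp(c s^α)` dominates `s^m` for `s ≥ 1`.
  obtain ⟨j, hj⟩ := exists_nat_ge ((m : ℝ) / α)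
  rw [div_le_iff₀ hα] at hj
  refine ⟨2 ^ m * (1 + j.factorial / c ^ j), by positivity, fun s hs => ?_⟩
  rcases le_total s 1 with h | h
  · calc (1 + s) ^ m * Real.exp (-(c * s ^ α)) ≤ 2 ^ m * 1 := by
          gcongr
          · linarith
          · rw [Real.exp_le_one_iff]
            have : 0 ≤ c * s ^ α := by positivity
            linarith
      _ ≤ _ := by
        gcongr
        have : 0 ≤ (j.factorial : ℝ) / c ^ j := by positivity
        linarith
  · have h1 : s ^ m ≤ (s ^ α) ^ j := by
      rw [← Real.rpow_natCast, ← Real.rpow_natCast, ← Real.rpow_mul hs]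
      exact Real.rpow_le_rpow_of_exponent_le h (by linarith)
    have h2 : (c * s ^ α) ^ j / j.factorial ≤ Real.exp (c * s ^ α) :=
      Real.pow_div_factorial_le_exp _ (by positivity) j
    have h3 : (1 + s) ^ m ≤ 2 ^ m * s ^ m := by
      rw [← mul_pow]
      gcongr
      linarith
    rw [Real.exp_neg, ← div_eq_mul_inv, div_le_iff₀ (Real.exp_pos _)]
    calc (1 + s) ^ m ≤ 2 ^ m * (s ^ α) ^ j := h3.trans (by gcongr)
      _ = 2 ^ m * ((j.factorial / c ^ j) * ((c * s ^ α) ^ j / j.factorial)) := by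
        rw [mul_pow]
        field_simp
      _ ≤ 2 ^ m * ((j.factorial / c ^ j) * Real.exp (c * s ^ α)) := by gcongr
      _ ≤ 2 ^ m * ((1 + j.factorial / c ^ j) * Real.exp (c * s ^ α)) := by
        gcongr
        linarith
      _ = _ := by ring

theorem integrable_one_add_pow_mul_exp {α c : ℝ} (hα : 0 < α) (hc : 0 < c) (m : ℕ) :
    Integrable (fun v : EuclideanSpace ℝ (Fin d) =>
      (1 + ‖v‖) ^ m * Real.exp (-(c * ‖v‖ ^ α))) := by
  -- The extra power `d + 1` is spent on the integrable weight `(1 + |v|)^{-(d+1)}`.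
  obtain ⟨A, hA0, hA⟩ := exists_one_add_pow_mul_exp_le hα hc (m + (d + 1))
  have hi : Integrable (fun v : EuclideanSpace ℝ (Fin d) => (1 + ‖v‖) ^ (-((d : ℝ) + 1))) :=
    integrable_one_add_norm (by simp)
  refine (hi.const_mul A).mono' ?_ (.of_forall fun v => ?_)
  · have : Continuous fun v : EuclideanSpace ℝ (Fin d) => ‖v‖ ^ α :=
      continuous_norm.rpow_const fun _ => Or.inr hα.le
    exact Continuous.aestronglyMeasurable (by fun_prop)
  · rw [Real.norm_of_nonneg (by positivity), Real.rpow_neg (by positivity), ← div_eq_mul_inv,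
      le_div_iff₀ (by positivity)]
    refine le_trans (le_of_eq ?_) (hA ‖v‖ (norm_nonneg v))
    rw [pow_add, ← Real.rpow_natCast _ (d + 1)]
    push_cast
    ring

/-- Uniform `L¹` bounds for the density with characteristic exponent the symbol of a measure `N`
supported in the unit ball, and for its gradient. -/
theorem exists_lintegral_fourier_exp_neg_symbol_le (d : ℕ) {α c : ℝ} (hα : 0 < α) (hc : 0 < c)
    (B C : ℝ) : ∃ K : ℝ≥0, ∀ N : Measure (EuclideanSpace ℝ (Fin d)), (∀ᵐ y ∂N, ‖y‖ ≤ 1) →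
      Integrable (fun y => ‖y‖ ^ 2) N → ∫ y, ‖y‖ ^ 2 ∂N ≤ C →
      (∀ w, c * ‖w‖ ^ α - B ≤ (symbol N ((2 * Real.pi) • w)).re) →
      Integrable (fun w => Complex.exp (-symbol N ((2 * Real.pi) • w))) ∧
      Integrable (fun w => ‖w‖ * ‖Complex.exp (-symbol N ((2 * Real.pi) • w))‖) ∧
      ∫⁻ x, ‖𝓕 (fun w => Complex.exp (-symbol N ((2 * Real.pi) • w))) x‖ₑ ≤ K ∧
      ∫⁻ x, ‖fderiv ℝ (𝓕 (fun w => Complex.exp (-symbol N ((2 * Real.pi) • w)))) x‖ₑ ≤ K := by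
  set m := d + 1 with hm
  set D : ℝ := (2 * Real.pi) ^ 2 * (1 + C)
  -- This majorant serves all derivatives of order at most `m` and depends on `N` only through the
  -- bounds `B`, `C` and `c`, so `K` is uniform in `N`. The power `m + 1` includes the weight `1 +
  -- |v|`.
  set h : EuclideanSpace ℝ (Fin d) → ℝ := fun v =>
    (m.factorial * Real.exp B * max 1 D ^ m) * ((1 + ‖v‖) ^ (m + 1) * Real.exp (-(c * ‖v‖ ^ α)))
  have hh : Integrable h := (integrable_one_add_pow_mul_exp hα hc (m + 1)).const_mul _
  set A : ℝ := 2 ^ (d + 2) * (2 * Real.pi * 4 ^ (d + 1) * (2 * (d + 2)) * ∫ v, h v)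
  have hi : Integrable (fun v : EuclideanSpace ℝ (Fin d) =>
      A * (1 + ‖v‖) ^ (-((d : ℝ) + 1))) :=
    (integrable_one_add_norm (by simp)).const_mul A
  refine ⟨(∫ v : EuclideanSpace ℝ (Fin d), A * (1 + ‖v‖) ^ (-((d : ℝ) + 1))).toNNReal,
    fun N h1 h2 hC hre => ?_⟩
  set f : EuclideanSpace ℝ (Fin d) → ℂ := fun w => Complex.exp (-symbol N ((2 * Real.pi) • w))
  have hf : ContDiff ℝ ∞ f := contDiff_exp_neg_symbol h1 h2
  have hC0 : 0 ≤ C := le_trans (integral_nonneg fun y => by positivity) hC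
  have hfh : ∀ n ≤ d + 1, ∀ v, (1 + ‖v‖) * ‖iteratedFDeriv ℝ n f v‖ ≤ h v := fun n hn v => by
    have h3 := norm_iteratedFDeriv_exp_neg_symbol_le h1 h2 hC n v
    have h4 : Real.exp (-(symbol N ((2 * Real.pi) • v)).re)
        ≤ Real.exp B * Real.exp (-(c * ‖v‖ ^ α)) := by
      rw [← Real.exp_add]
      exact Real.exp_le_exp.2 (by linarith [hre v])
    have h5 : (D * (1 + ‖v‖)) ^ n ≤ max 1 D ^ m * (1 + ‖v‖) ^ m := by
      rw [← mul_pow]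
      have h6 : D * (1 + ‖v‖) ≤ max 1 D * (1 + ‖v‖) := by gcongr; exact le_max_right _ _
      have h7 : 1 ≤ max 1 D * (1 + ‖v‖) :=
        one_le_mul_of_one_le_of_one_le (le_max_left _ _) (by linarith [norm_nonneg v])
      exact (pow_le_pow_left₀ (by positivity) h6 n).trans (pow_le_pow_right₀ h7 hn)
    have h8 : (n.factorial : ℝ) ≤ m.factorial := by exact_mod_cast Nat.factorial_le hn
    calc (1 + ‖v‖) * ‖iteratedFDeriv ℝ n f v‖
        ≤ (1 + ‖v‖) * (m.factorial * (Real.exp B * Real.exp (-(c * ‖v‖ ^ α)))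
          * (max 1 D ^ m * (1 + ‖v‖) ^ m)) := by
          gcongr
          exact h3.trans (by gcongr)
      _ = h v := by simp only [h]; ring
  have hdecay : ∀ k ≤ 1, ∫⁻ x, ‖iteratedFDeriv ℝ k (𝓕 f) x‖ₑ
      ≤ ENNReal.ofReal (∫ v : EuclideanSpace ℝ (Fin d), A * (1 + ‖v‖) ^ (-((d : ℝ) + 1))) :=
    fun k hk => by
      have h9 := norm_iteratedFDeriv_fourier_le_of_dominated hf hh hfh hk
      rw [ofReal_integral_eq_lintegral_ofReal hi
        (.of_forall fun v => (norm_nonneg _).trans (h9 v))]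
      refine lintegral_mono fun x => ?_
      rw [← ofReal_norm]
      exact ENNReal.ofReal_le_ofReal (h9 x)
  have hfc : Continuous f := hf.continuous
  refine ⟨?_, ?_, ?_, ?_⟩
  · refine hh.mono' hfc.aestronglyMeasurable (.of_forall fun v => le_trans ?_ (hfh 0 (by omega) v))
    rw [norm_iteratedFDeriv_zero]
    exact le_mul_of_one_le_left (norm_nonneg _) (by linarith [norm_nonneg v])
  · refine hh.mono' (continuous_norm.mul hfc.norm).aestronglyMeasurable
      (.of_forall fun v => le_trans ?_ (hfh 0 (by omega) v))
    rw [norm_iteratedFDeriv_zero, Real.norm_of_nonneg (by positivity)]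
    gcongr
    linarith
  · refine le_trans (le_of_eq (lintegral_congr fun x => ?_)) (hdecay 0 (by omega))
    rw [← ofReal_norm, ← ofReal_norm, norm_iteratedFDeriv_zero]
  · refine le_trans (le_of_eq (lintegral_congr fun x => ?_)) (hdecay 1 le_rfl)
    rw [← ofReal_norm, ← ofReal_norm, ← norm_iteratedFDeriv_fderiv, norm_iteratedFDeriv_zero]

end FourierDecay

end LevyGradient

namespace LevyGradient

open scoped FourierTransform RealInnerProductSpace ContDiff

/-! ### Regularization by a density with integrable gradient -/

section Density

variable {E : Type} [NormedAddCommGroup E] [InnerProductSpace ℝ E] [FiniteDimensional ℝ E]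
  [MeasurableSpace E] [BorelSpace E]

theorem integrable_bounded_mul (F : E →ᵇ ℝ) {V : Type*} [NormedAddCommGroup V] [NormedSpace ℝ V]
    {q : E → V} (hq : Integrable q) (x : E) : Integrable (fun y => F (x + y) • q y) := by
  have hF : Continuous fun y => F (x + y) := by fun_prop
  refine (hq.norm.const_mul ‖F‖).mono' (hF.aestronglyMeasurable.smul hq.1)
    (.of_forall fun y => ?_)
  rw [norm_smul]
  gcongr
  exact F.norm_coe_le_norm _

theorem continuous_integral_bounded_smul (F : E →ᵇ ℝ) {V : Type*} [NormedAddCommGroup V]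
    [NormedSpace ℝ V] {q : E → V} (hq : Integrable q) :
    Continuous (fun x => ∫ y, F (x + y) • q y) := by
  refine continuous_of_dominated (bound := fun y => ‖F‖ * ‖q y‖)
    (fun x => (integrable_bounded_mul F hq x).1) (fun x => .of_forall fun y => ?_)
    (hq.norm.const_mul _) (.of_forall fun y => by fun_prop)
  rw [norm_smul]
  gcongr
  exact F.norm_coe_le_norm _

theorem integrable_fderiv_comp_sub_smul {q : E → ℝ} (hqc : Continuous (fderiv ℝ q))
    (hq' : Integrable (fderiv ℝ q)) (v : E) :
    Integrable (fun z : ℝ × E => fderiv ℝ q (z.2 - z.1 • v))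
      ((volume.restrict (Ioc 0 1)).prod volume) := by
  have hc : Continuous fun z : ℝ × E => fderiv ℝ q (z.2 - z.1 • v) := by fun_prop
  rw [integrable_prod_iff hc.aestronglyMeasurable]
  refine ⟨.of_forall fun s => hq'.comp_sub_right (s • v), ?_⟩
  have : ∀ s : ℝ, ∫ y, ‖fderiv ℝ q (y - s • v)‖ = ∫ y, ‖fderiv ℝ q y‖ := fun s =>
    integral_sub_right_eq_self (fun y => ‖fderiv ℝ q y‖) (s • v)
  simp only [this]
  exact integrable_const _

/-- As `F` is only continuous, the increment is transferred to `q` by translation. The fundamental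
theorem of calculus along the segment and Fubini then apply, and translating back returns the shift
to `F`. -/
theorem integral_bounded_mul_sub_eq (F : E →ᵇ ℝ) {q : E → ℝ} (hq : ContDiff ℝ 1 q)
    (hqi : Integrable q) (hq' : Integrable (fderiv ℝ q)) (x v : E) :
    (∫ y, F (x + v + y) • q y) - ∫ y, F (x + y) • q y
      = ∫ s in (0 : ℝ)..1, (-∫ y, F (x + s • v + y) • fderiv ℝ q y) v := by
  have hqc : Continuous (fderiv ℝ q) := hq.continuous_fderiv one_ne_zero
  have htr : ∀ {V : Type} [NormedAddCommGroup V] [NormedSpace ℝ V] (q : E → V) (w : E),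
      ∫ y, F (x + w + y) • q y = ∫ y, F (x + y) • q (y - w) := fun q w => by
    rw [← integral_sub_right_eq_self (fun y => F (x + w + y) • q y) w]
    congr 1
    ext y
    congr 2
    abel_nf
  have hline : ∀ y, q (y - v) - q y = ∫ s in (0 : ℝ)..1, -(fderiv ℝ q (y - s • v) v) := fun y => by
    have hd : ∀ s : ℝ, HasDerivAt (fun s : ℝ => q (y - s • v)) (-(fderiv ℝ q (y - s • v) v)) s :=
      fun s => by
        have h1 : HasDerivAt (fun s : ℝ => y - s • v) (-v) s := by
          simpa using ((hasDerivAt_id s).smul_const v).const_sub y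
        have h2 := (hq.differentiable one_ne_zero (y - s • v)).hasFDerivAt.comp_hasDerivAt s h1
        simp only [map_neg] at h2
        exact h2
    have hc : Continuous fun s : ℝ => -(fderiv ℝ q (y - s • v) v) := by fun_prop
    rw [intervalIntegral.integral_eq_sub_of_hasDerivAt (fun s _ => hd s)
      (hc.intervalIntegrable 0 1)]
    simp
  have hi := integrable_fderiv_comp_sub_smul hqc hq' v
  have hFi : Integrable (fun z : ℝ × E => F (x + z.2) • -(fderiv ℝ q (z.2 - z.1 • v) v))
      ((volume.restrict (Ioc 0 1)).prod volume) := by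
    refine (hi.norm.const_mul (‖F‖ * ‖v‖)).mono' (Continuous.aestronglyMeasurable (by fun_prop))
      (.of_forall fun z => ?_)
    rw [norm_smul, norm_neg, mul_assoc]
    gcongr
    · exact F.norm_coe_le_norm _
    · rw [mul_comm]
      exact ContinuousLinearMap.le_opNorm _ _
  rw [htr q v, ← integral_sub (integrable_bounded_mul F (hqi.comp_sub_right v) x)
    (integrable_bounded_mul F hqi x)]
  simp only [← smul_sub, hline, intervalIntegral.integral_of_le zero_le_one, ← integral_smul]
  rw [← integral_integral_swap hFi]
  refine integral_congr_ae (.of_forall fun s => ?_)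
  beta_reduce
  rw [htr (fderiv ℝ q) (s • v), neg_apply, ContinuousLinearMap.integral_apply
    (integrable_bounded_mul F (hq'.comp_sub_right (s • v)) x), ← integral_neg]
  simp

/-- The increment is the integral of the candidate derivative along the segment, and that candidate
is continuous in the base point. -/
theorem hasFDerivAt_integral_bounded_smul (F : E →ᵇ ℝ) {q : E → ℝ} (hq : ContDiff ℝ 1 q)
    (hqi : Integrable q) (hq' : Integrable (fderiv ℝ q)) (x : E) :
    HasFDerivAt (fun x => ∫ y, F (x + y) • q y) (-∫ y, F (x + y) • fderiv ℝ q y) x := by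
  set D : E → E →L[ℝ] ℝ := fun x => -∫ y, F (x + y) • fderiv ℝ q y with hD
  have hDc : Continuous D := (continuous_integral_bounded_smul F hq').neg
  change HasFDerivAt _ (D x) x
  rw [hasFDerivAt_iff_isLittleO_nhds_zero, Asymptotics.isLittleO_iff]
  intro ε hε
  obtain ⟨δ, hδ, hball⟩ := Metric.continuousAt_iff.1 (hDc.continuousAt (x := x)) ε hε
  filter_upwards [Metric.ball_mem_nhds (0 : E) hδ] with v hv
  rw [mem_ball_zero_iff] at hv
  have h1 := integral_bounded_mul_sub_eq F hq hqi hq' x v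
  have h2 : ∫ _ in (0 : ℝ)..1, D x v = D x v := by simp
  have hc : Continuous fun s : ℝ => D (x + s • v) v := by fun_prop
  rw [h1, ← h2, ← intervalIntegral.integral_sub (hc.intervalIntegrable 0 1)
    (continuous_const.intervalIntegrable 0 1)]
  have h3 : ∀ s ∈ uIoc (0 : ℝ) 1, ‖D (x + s • v) v - D x v‖ ≤ ε * ‖v‖ := fun s hs => by
    rw [uIoc_of_le zero_le_one] at hs
    rw [← sub_apply]
    refine (ContinuousLinearMap.le_opNorm _ _).trans ?_
    gcongr
    rw [← dist_eq_norm]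
    refine (hball ?_).le
    rw [dist_eq_norm, add_sub_cancel_left, norm_smul, Real.norm_of_nonneg hs.1.le]
    exact (mul_le_of_le_one_left (norm_nonneg v) hs.2).trans_lt hv
  simpa using intervalIntegral.norm_integral_le_of_norm_le_const h3

/-- Averaging a bounded continuous function against a `W^{1,1}` density yields a `C¹` function. -/
theorem contDiff_integral_bounded_smul (F : E →ᵇ ℝ) {q : E → ℝ} (hq : ContDiff ℝ 1 q)
    (hqi : Integrable q) (hq' : Integrable (fderiv ℝ q)) :
    ContDiff ℝ 1 (fun x => ∫ y, F (x + y) • q y) := by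
  have h := hasFDerivAt_integral_bounded_smul F hq hqi hq'
  rw [contDiff_one_iff_fderiv]
  refine ⟨fun x => (h x).differentiableAt, ?_⟩
  rw [show fderiv ℝ (fun x => ∫ y, F (x + y) • q y) = fun x => -∫ y, F (x + y) • fderiv ℝ q y from
    funext fun x => (h x).fderiv]
  exact (continuous_integral_bounded_smul F hq').neg

theorem norm_fderiv_integral_bounded_smul_le (F : E →ᵇ ℝ) {q : E → ℝ} (hq : ContDiff ℝ 1 q)
    (hqi : Integrable q) (hq' : Integrable (fderiv ℝ q)) (x : E) :
    ‖fderiv ℝ (fun x => ∫ y, F (x + y) • q y) x‖ ≤ (∫ y, ‖fderiv ℝ q y‖) * ‖F‖ := by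
  rw [(hasFDerivAt_integral_bounded_smul F hq hqi hq' x).fderiv, norm_neg, mul_comm,
    ← integral_const_mul]
  refine norm_integral_le_of_norm_le (hq'.norm.const_mul _) (.of_forall fun y => ?_)
  rw [norm_smul]
  gcongr
  exact F.norm_coe_le_norm _

theorem charFun_withDensity_ofReal {q : E → ℝ} (hq : Measurable q) (t : E) :
    charFun (volume.withDensity fun x => ENNReal.ofReal (q x)) t
      = ∫ x, ((max (q x) 0 : ℝ) : ℂ) * Complex.exp (⟪x, t⟫ * Complex.I) := by
  rw [charFun_apply, integral_withDensity_eq_integral_toReal_smul hq.ennreal_ofReal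
    (.of_forall fun x => ENNReal.ofReal_lt_top)]
  simp only [ENNReal.toReal_ofReal', Complex.real_smul]

/-- If the characteristic function of `μ` is the Fourier transform of an integrable function `q`,
then `μ` integrates like `q`. -/
theorem integral_eq_integral_smul_of_charFun_eq {μ : Measure E} [IsFiniteMeasure μ] {q : E → ℝ}
    (hqc : Continuous q) (hq : Integrable q)
    (h : ∀ t, charFun μ t = ∫ x, (q x : ℂ) * Complex.exp (⟪x, t⟫ * Complex.I)) (F : E →ᵇ ℝ) :
    ∫ x, F x ∂μ = ∫ x, F x • q x := by
  have hfin : ∀ q : E → ℝ, Integrable q →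
      IsFiniteMeasure (volume.withDensity fun x => ENNReal.ofReal (q x)) := fun q hq =>
    isFiniteMeasure_withDensity_ofReal hq.2
  have := hfin q hq
  have := hfin (fun x => -q x) hq.neg
  have hpos : ∀ q : E → ℝ, Integrable q → Integrable (fun x => max (q x) 0) := fun q hq =>
    hq.pos_part
  have hexp : ∀ (q : E → ℝ) (t : E), Integrable q →
      Integrable (fun x => (q x : ℂ) * Complex.exp (⟪x, t⟫ * Complex.I)) := fun q t hq => by
    refine hq.norm.mono' (hq.ofReal.1.mul (Continuous.aestronglyMeasurable (by fun_prop)))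
      (.of_forall fun x => ?_)
    rw [norm_mul, Complex.norm_exp_ofReal_mul_I, mul_one, Complex.norm_real]
  -- The sign of `q` is not known in advance. Moving its negative part to the other side leaves two
  -- finite positive measures, which are identified by their characteristic functions.
  have key : μ + volume.withDensity (fun x => ENNReal.ofReal (-q x))
      = volume.withDensity fun x => ENNReal.ofReal (q x) := by
    refine Measure.ext_of_charFun (funext fun t => ?_)
    have hint : ∀ ν : Measure E, IsFiniteMeasure ν →
        Integrable (fun z => Complex.exp (⟪z, t⟫ * Complex.I)) ν := fun ν _ =>
      (integrable_const (1 : ℝ)).mono (Continuous.aestronglyMeasurable (by fun_prop))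
        (.of_forall fun z => by simp [Complex.norm_exp_ofReal_mul_I])
    rw [charFun_apply, integral_add_measure (hint _ inferInstance) (hint _ inferInstance),
      ← charFun_apply, ← charFun_apply, h, charFun_withDensity_ofReal hqc.measurable,
      charFun_withDensity_ofReal (q := fun x => -q x) hqc.neg.measurable,
      ← integral_add (hexp q t hq) (hexp _ t (hpos (fun x => -q x) hq.neg))]
    refine integral_congr_ae (.of_forall fun x => ?_)
    beta_reduce
    rw [← add_mul, ← Complex.ofReal_add]
    congr 2
    rcases le_total (q x) 0 with hx | hx
    · rw [max_eq_left (by simpa using hx), max_eq_right hx, add_neg_cancel]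
    · rw [max_eq_right (by simpa using hx), max_eq_left hx, add_zero]
  have hFq : ∀ q : E → ℝ, Measurable q →
      ∫ x, F x ∂(volume.withDensity fun x => ENNReal.ofReal (q x)) = ∫ x, F x • max (q x) 0 :=
    fun q hq => by
      rw [integral_withDensity_eq_integral_toReal_smul hq.ennreal_ofReal
        (.of_forall fun x => ENNReal.ofReal_lt_top)]
      simp only [ENNReal.toReal_ofReal', smul_eq_mul, mul_comm]
  have hF := congrArg (fun ν => ∫ x, F x ∂ν) key
  beta_reduce at hF
  rw [integral_add_measure (F.integrable _) (F.integrable _), hFq q hqc.measurable,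
    hFq (fun x => -q x) hqc.neg.measurable] at hF
  have hFi : ∀ q : E → ℝ, Integrable q → Integrable (fun x => F x • q x) := fun q hq => by
    simpa using integrable_bounded_mul F hq 0
  rw [eq_sub_of_add_eq hF, ← integral_sub (hFi _ (hpos _ hq)) (hFi _ (hpos (fun x => -q x) hq.neg))]
  refine integral_congr_ae (.of_forall fun x => ?_)
  beta_reduce
  rw [← smul_sub]
  congr 1
  rcases le_total (q x) 0 with hx | hx
  · rw [max_eq_right hx, max_eq_left (by simpa using hx)]
    ring
  · rw [max_eq_left hx, max_eq_right (by simpa using hx), sub_zero]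

/-- Conjugating `charFun` amounts to `w ↦ -w`, so its Fourier integral equals its own conjugate. -/
theorem im_fourier_charFun_eq_zero (μ : Measure E) (x : E) :
    (𝓕 (fun w => charFun μ ((2 * Real.pi) • w)) x).im = 0 := by
  rw [← Complex.conj_eq_iff_im, Real.fourier_eq, ← integral_conj,
    ← integral_neg_eq_self (fun w => Real.fourierChar (-⟪w, x⟫) • charFun μ ((2 * Real.pi) • w))]
  refine integral_congr_ae (.of_forall fun w => ?_)
  simp only [smul_neg, charFun_neg, inner_neg_left, neg_neg, Circle.smul_def, smul_eq_mul, map_mul]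
  congr 1
  rw [← Circle.coe_inv_eq_conj, ← AddChar.map_neg_eq_inv, neg_neg]

/-- Suppose that the characteristic function of `μ` is the product of a Fourier contraction and of
an integrable function `f` whose Fourier transform has a gradient in `L¹`. Then convolution with
`μ` regularizes bounded continuous functions. -/
theorem contDiff_and_norm_fderiv_le_of_charFun_eq {μ : Measure E} [IsProbabilityMeasure μ]
    {χ f : E → ℂ} (hχ : IsFourierContraction χ)
    (hμ : ∀ w, charFun μ ((2 * Real.pi) • w) = χ w * f w)
    (hf : Integrable f) (hf' : Integrable (fun w => ‖w‖ * ‖f w‖)) {K : ℝ≥0}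
    (hK : ∫⁻ x, ‖𝓕 f x‖ₑ ≤ K) (hK' : ∫⁻ x, ‖fderiv ℝ (𝓕 f) x‖ₑ ≤ K) (F : E →ᵇ ℝ) :
    ContDiff ℝ 1 (fun x => ∫ y, F (x + y) ∂μ) ∧
      ∀ x, ‖fderiv ℝ (fun x => ∫ y, F (x + y) ∂μ) x‖ ≤ K * ‖F‖ := by
  set Φ : E → ℂ := fun w => charFun μ ((2 * Real.pi) • w) with hΦ
  have hΦe : Φ = fun w => χ w • f w := funext fun w => hμ w
  have hΦi : Integrable Φ := hΦe ▸ hχ.integrable_smul hf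
  have hΦi' : Integrable (fun w => ‖w‖ * ‖Φ w‖) := by
    refine hf'.mono' (continuous_norm.aestronglyMeasurable.mul hΦi.1.norm) (.of_forall fun w => ?_)
    rw [Real.norm_of_nonneg (by positivity), hΦe, norm_smul]
    gcongr
    exact mul_le_of_le_one_left (norm_nonneg _) (hχ.norm_le_one w)
  have hΦc : Continuous Φ := continuous_charFun.comp (continuous_const_smul _)
  set p : E → ℂ := 𝓕 Φ with hp
  have hpc : Continuous p := continuous_fourier_of_integrable hΦi
  have hpi : Integrable p := by
    refine ⟨hpc.aestronglyMeasurable, ?_⟩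
    rw [HasFiniteIntegral, hp, hΦe]
    exact ((hχ.lintegral_le f hf).trans hK).trans_lt ENNReal.coe_lt_top
  have hpd : Differentiable ℝ p := Real.differentiable_fourier hΦi hΦi'
  have hsm : ∀ {f : E → ℂ}, Integrable f → Integrable (fun w => ‖w‖ * ‖f w‖) →
      Integrable (VectorFourier.fourierSMulRight (innerSL ℝ) f) := fun {f} hf hf' => by
    refine (hf'.const_mul (2 * Real.pi)).mono'
      (hf.1.fourierSMulRight) (.of_forall fun w => ?_)
    refine (VectorFourier.norm_fourierSMulRight_le _ _ _).trans ?_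
    calc _ ≤ 2 * Real.pi * 1 * ‖w‖ * ‖f w‖ := by gcongr; exact norm_innerSL_le _
      _ = _ := by ring
  have hpf : fderiv ℝ p = 𝓕 (VectorFourier.fourierSMulRight (innerSL ℝ) Φ) :=
    Real.fderiv_fourier hΦi hΦi'
  have hpfc : Continuous (fderiv ℝ p) := by
    rw [hpf]
    exact continuous_fourier_of_integrable (hsm hΦi hΦi')
  have hpfl : ∫⁻ x, ‖fderiv ℝ p x‖ₑ ≤ K := by
    -- Differentiating the transform multiplies by a linear factor in `w`, which commutes with `χ`.
    -- The contraction property then applies to functions with values in a space of linear maps,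
    -- which is why `IsFourierContraction` allows vector-valued `G`.
    have h1 : VectorFourier.fourierSMulRight (innerSL ℝ) Φ
        = fun w => χ w • VectorFourier.fourierSMulRight (innerSL ℝ) f w := by
      ext w v
      simp only [VectorFourier.fourierSMulRight_apply, hΦe, smul_apply]
      simp only [Complex.real_smul, smul_eq_mul]
      ring
    rw [hpf, h1]
    refine (hχ.lintegral_le _ (hsm hf hf')).trans ?_
    rwa [← Real.fderiv_fourier hf hf']
  set q : E → ℝ := fun x => (p x).re with hq
  have hpq : ∀ x, p x = (q x : ℂ) := fun x =>
    Complex.ext rfl (by simpa using im_fourier_charFun_eq_zero μ x)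
  have hqd : ∀ x, HasFDerivAt q (Complex.reCLM.comp (fderiv ℝ p x)) x := fun x =>
    Complex.reCLM.hasFDerivAt.comp x (hpd x).hasFDerivAt
  have hqf : fderiv ℝ q = fun x => Complex.reCLM.comp (fderiv ℝ p x) :=
    funext fun x => (hqd x).fderiv
  have hqfc : Continuous (fderiv ℝ q) := by
    rw [hqf]
    fun_prop
  have hqC1 : ContDiff ℝ 1 q :=
    contDiff_one_iff_fderiv.2 ⟨fun x => (hqd x).differentiableAt, hqfc⟩
  have hqi : Integrable q := hpi.re
  have hqle : ∀ x, ‖fderiv ℝ q x‖ₑ ≤ ‖fderiv ℝ p x‖ₑ := fun x => by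
    rw [hqf, ← ofReal_norm, ← ofReal_norm]
    refine ENNReal.ofReal_le_ofReal ((ContinuousLinearMap.opNorm_comp_le _ _).trans ?_)
    rw [Complex.reCLM_norm, one_mul]
  have hql : ∫⁻ x, ‖fderiv ℝ q x‖ₑ ≤ K := (lintegral_mono hqle).trans hpfl
  have hqi' : Integrable (fderiv ℝ q) :=
    ⟨hqfc.aestronglyMeasurable, hql.trans_lt ENNReal.coe_lt_top⟩
  have hch : ∀ t, charFun μ t = ∫ x, (q x : ℂ) * Complex.exp (⟪x, t⟫ * Complex.I) := fun t => by
    -- Fourier inversion is available because the contraction made `p` integrable.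
    have h2 : 𝓕⁻ p = Φ := hΦc.fourierInv_fourier_eq hΦi hpi
    have h3 := congrFun h2 ((2 * Real.pi)⁻¹ • t)
    simp only [hΦ] at h3
    rw [smul_smul, mul_inv_cancel₀ (by positivity), one_smul] at h3
    rw [← h3, Real.fourierInv_eq]
    refine integral_congr_ae (.of_forall fun x => ?_)
    beta_reduce
    rw [Circle.smul_def, hpq, Real.fourierChar_apply, smul_eq_mul, mul_comm, inner_smul_right]
    congr 2
    push_cast
    field_simp
  have hrep : (fun x => ∫ y, F (x + y) ∂μ) = fun x => ∫ y, F (x + y) • q y := funext fun x =>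
    integral_eq_integral_smul_of_charFun_eq hqC1.continuous hqi hch
      (F.compContinuous ⟨fun y => x + y, by fun_prop⟩)
  rw [hrep]
  refine ⟨contDiff_integral_bounded_smul F hqC1 hqi hqi', fun x => ?_⟩
  refine (norm_fderiv_integral_bounded_smul_le F hqC1 hqi hqi' x).trans ?_
  gcongr
  rw [integral_norm_eq_lintegral_enorm hqi'.1]
  exact ENNReal.toReal_le_of_le_ofReal K.2 (by simpa using hql)

end Density

end LevyGradient

namespace LevyGradient

open scoped FourierTransform RealInnerProductSpace ContDiff

/-! ### Rescaled small jumps and scale-uniform control of their moments and symbol -/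

section SmallJumps

variable {d : ℕ} {ν : Measure (EuclideanSpace ℝ (Fin d))}

theorem IsLevyMeasure.re_symbol_nonneg (hν : IsLevyMeasure ν) (u : EuclideanSpace ℝ (Fin d)) :
    0 ≤ (symbol ν u).re := by
  rw [hν.re_symbol]
  exact integral_nonneg fun z => by simpa using Real.cos_le_one _

/-- On the bounded set of frequencies not covered by the hypothesis, the general quadratic bound on
the integrand gives a constant. -/
theorem IsLevyMeasure.exists_re_symbol_le (hν : IsLevyMeasure ν) {α c M : ℝ} (hc : 0 ≤ c)
    (hψ : ∀ y, M < ‖y‖ → (symbol ν y).re ≤ c * ‖y‖ ^ α) :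
    ∃ A : ℝ, 0 ≤ A ∧ ∀ u, (symbol ν u).re ≤ A * (1 + ‖u‖ ^ α) := by
  obtain ⟨I, hI⟩ : ∃ I, I = ∫ z, min 1 (‖z‖ ^ 2) ∂ν := ⟨_, rfl⟩
  have hI0 : 0 ≤ I := hI ▸ integral_nonneg fun z => by positivity
  refine ⟨c + (2 + 3 * M ^ 2) * I, by positivity, fun u => ?_⟩
  have hu : 0 ≤ ‖u‖ ^ α := by positivity
  have hJ : 0 ≤ (2 + 3 * M ^ 2) * I := by positivity
  rcases lt_or_ge M ‖u‖ with h | h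
  · refine (hψ u h).trans ?_
    nlinarith [mul_nonneg hJ hu]
  · have h1 : (symbol ν u).re ≤ (2 + 3 * ‖u‖ ^ 2) * I := by
      refine (Complex.re_le_norm _).trans ?_
      rw [symbol_eq, norm_neg, hI, ← integral_const_mul]
      exact norm_integral_le_of_norm_le (hν.integrable_min.const_mul _)
        (.of_forall (norm_levyIntegrand_le u))
    have h2 : (2 + 3 * ‖u‖ ^ 2) * I ≤ (2 + 3 * M ^ 2) * I := by gcongr
    nlinarith [mul_nonneg hJ hu, mul_nonneg hc hu]

/-- From `e^x ≥ 1 + x` the right side is at least `3a/(2 + a)`, which equals one at `a = 1`; hence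
the constant `3`. It is applied with `a` a squared norm. -/
theorem min_one_sq_le_one_sub_exp (a : ℝ) (ha : 0 ≤ a) : min 1 a ≤ 3 * (1 - Real.exp (-a / 2)) := by
  have h1 : Real.exp (-a / 2) ≤ 1 / (1 + a / 2) := by
    rw [show -a / 2 = -(a / 2) by ring, Real.exp_neg, ← one_div]
    exact one_div_le_one_div_of_le (by positivity) (by linarith [Real.add_one_le_exp (a / 2)])
  have h2 : min 1 a ≤ 3 * (1 - 1 / (1 + a / 2)) := by
    rw [show 3 * (1 - 1 / (1 + a / 2)) = 3 * a / (2 + a) by field_simp; ring,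
      le_div_iff₀ (by positivity)]
    rcases le_total a 1 with h | h
    · rw [min_eq_right h]; nlinarith
    · rw [min_eq_left h]; linarith
  linarith

theorem integral_one_sub_cos_stdGaussian (z : EuclideanSpace ℝ (Fin d)) :
    ∫ u, (1 - Real.cos ⟪u, z⟫) ∂(stdGaussian (EuclideanSpace ℝ (Fin d)))
      = 1 - Real.exp (-‖z‖ ^ 2 / 2) := by
  have hi : Integrable (fun u => Complex.exp (⟪u, z⟫ * Complex.I))
      (stdGaussian (EuclideanSpace ℝ (Fin d))) :=
    (integrable_const (1 : ℝ)).mono (Continuous.aestronglyMeasurable (by fun_prop))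
      (.of_forall fun z => by simp [Complex.norm_exp_ofReal_mul_I])
  have h := charFun_stdGaussian z
  rw [charFun_apply] at h
  have h2 : ∫ u, Real.cos ⟪u, z⟫ ∂(stdGaussian (EuclideanSpace ℝ (Fin d)))
      = Real.exp (-‖z‖ ^ 2 / 2) := by
    have h3 := integral_re hi
    simp only [RCLike.re_to_complex, Complex.exp_ofReal_mul_I_re] at h3
    rw [h3, h, show (-(‖z‖ : ℂ) ^ 2 / 2) = ((-‖z‖ ^ 2 / 2 : ℝ) : ℂ) by push_cast; ring]
    exact Complex.exp_ofReal_re _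
  have hc : Integrable (fun u => Real.cos ⟪u, z⟫) (stdGaussian (EuclideanSpace ℝ (Fin d))) := by
    simpa only [RCLike.re_to_complex, Complex.exp_ofReal_mul_I_re] using hi.re
  rw [integral_sub (integrable_const _) hc, h2]
  simp

/-- An upper bound of order `|u|^α` for the real part of the symbol controls the mass of the Lévy
measure at all small scales. -/
theorem IsLevyMeasure.exists_integral_min_le (hν : IsLevyMeasure ν) {α c M : ℝ} (hα : 0 ≤ α)
    (hα2 : α ≤ 2) (hc : 0 ≤ c) (hψ : ∀ y, M < ‖y‖ → (symbol ν y).re ≤ c * ‖y‖ ^ α) :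
    ∃ C : ℝ, 0 ≤ C ∧ ∀ r : ℝ, 0 < r → r ≤ 1 →
      ∫ z, min 1 (‖r⁻¹ • z‖ ^ 2) ∂ν ≤ C * (r ^ α)⁻¹ := by
  obtain ⟨A, hA, hAu⟩ := hν.exists_re_symbol_le hc hψ
  set γ := stdGaussian (EuclideanSpace ℝ (Fin d))
  have hsq : Integrable (fun u => 2 + ‖u‖ ^ 2) γ := by
    have := (IsGaussian.memLp_id γ 2 (by simp)).integrable_norm_pow (by norm_num)
    exact (integrable_const _).add this
  have := hν.sigmaFinite
  have hG : 0 ≤ ∫ u, (2 + ‖u‖ ^ 2) ∂γ := integral_nonneg fun u => by positivity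
  refine ⟨3 * (A * ∫ u, (2 + ‖u‖ ^ 2) ∂γ), by positivity, fun r hr hr1 => ?_⟩
  have hrα : 1 ≤ (r ^ α)⁻¹ := (one_le_inv₀ (by positivity)).2 (Real.rpow_le_one hr.le hr1 hα)
  -- Since `r ≤ 1` and `0 ≤ α ≤ 2`, `1 + r^{-α}|u|^α ≤ r^{-α}(2 + |u|²)`, and the Gaussian
  -- integrates the last factor.
  have hbound : ∀ u, (symbol ν (r⁻¹ • u)).re ≤ A * (r ^ α)⁻¹ * (2 + ‖u‖ ^ 2) := fun u => by
    refine (hAu _).trans ?_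
    rw [mul_assoc]
    gcongr
    rw [norm_smul, Real.norm_of_nonneg (by positivity), Real.mul_rpow (by positivity) (norm_nonneg _),
      Real.inv_rpow hr.le]
    have h1 : ‖u‖ ^ α ≤ 1 + ‖u‖ ^ 2 := by
      rcases le_total ‖u‖ 1 with h | h
      · linarith [Real.rpow_le_one (norm_nonneg u) h hα, sq_nonneg ‖u‖]
      · have := Real.rpow_le_rpow_of_exponent_le h hα2
        rw [Real.rpow_two] at this
        linarith
    nlinarith
  have hcos : ∀ u z : EuclideanSpace ℝ (Fin d), 0 ≤ 1 - Real.cos ⟪r⁻¹ • u, z⟫ := fun u z => by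
    linarith [Real.cos_le_one ⟪r⁻¹ • u, z⟫]
  -- The quantity `1 - exp(-|z/r|²/2)` is the Gaussian mean of `1 - cos⟨u/r, z⟩`. Exchanging the
  -- integrals turns the `ν`-integral into the Gaussian mean of `Re ψ(u/r)`.
  have hlin : ∫⁻ z, ENNReal.ofReal (min 1 (‖r⁻¹ • z‖ ^ 2)) ∂ν
      ≤ ENNReal.ofReal (3 * (A * ∫ u, (2 + ‖u‖ ^ 2) ∂γ) * (r ^ α)⁻¹) :=
    calc ∫⁻ z, ENNReal.ofReal (min 1 (‖r⁻¹ • z‖ ^ 2)) ∂ν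
        ≤ ∫⁻ z, 3 * ∫⁻ u, ENNReal.ofReal (1 - Real.cos ⟪r⁻¹ • u, z⟫) ∂γ ∂ν := by
          refine lintegral_mono fun z => ?_
          have h1 : Integrable (fun u => 1 - Real.cos ⟪r⁻¹ • u, z⟫) γ := by
            refine (integrable_const (2 : ℝ)).mono' (Continuous.aestronglyMeasurable (by fun_prop))
              (.of_forall fun u => ?_)
            rw [Real.norm_of_nonneg (hcos u z)]
            linarith [Real.neg_one_le_cos ⟪r⁻¹ • u, z⟫]
          rw [← ofReal_integral_eq_lintegral_ofReal h1 (.of_forall fun u => hcos u z)]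
          have h2 : ∫ u, (1 - Real.cos ⟪u, r⁻¹ • z⟫) ∂γ = 1 - Real.exp (-‖r⁻¹ • z‖ ^ 2 / 2) :=
            integral_one_sub_cos_stdGaussian (r⁻¹ • z)
          simp only [real_inner_smul_right] at h2
          simp only [real_inner_smul_left, h2]
          rw [show (3 : ℝ≥0∞) = ENNReal.ofReal 3 by simp, ← ENNReal.ofReal_mul (by norm_num)]
          exact ENNReal.ofReal_le_ofReal (min_one_sq_le_one_sub_exp _ (by positivity))
      _ = 3 * ∫⁻ u, ∫⁻ z, ENNReal.ofReal (1 - Real.cos ⟪r⁻¹ • u, z⟫) ∂ν ∂γ := by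
          rw [lintegral_const_mul' _ _ (by simp), lintegral_lintegral_swap]
          exact (ENNReal.continuous_ofReal.comp (by fun_prop)).aemeasurable
      _ = 3 * ∫⁻ u, ENNReal.ofReal (symbol ν (r⁻¹ • u)).re ∂γ := by
          congr 1
          refine lintegral_congr fun u => ?_
          rw [hν.re_symbol, ofReal_integral_eq_lintegral_ofReal (hν.integrable_one_sub_cos _)
            (.of_forall fun z => hcos u z)]
      _ ≤ 3 * ∫⁻ u, ENNReal.ofReal (A * (r ^ α)⁻¹ * (2 + ‖u‖ ^ 2)) ∂γ := by
          gcongr with u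
          exact hbound u
      _ = ENNReal.ofReal (3 * (A * ∫ u, (2 + ‖u‖ ^ 2) ∂γ) * (r ^ α)⁻¹) := by
          rw [← ofReal_integral_eq_lintegral_ofReal (hsq.const_mul _)
            (.of_forall fun u => by positivity), integral_const_mul,
            show (3 : ℝ≥0∞) = ENNReal.ofReal 3 by simp, ← ENNReal.ofReal_mul (by norm_num)]
          congr 1
          ring
  rw [integral_eq_lintegral_of_nonneg_ae (.of_forall fun z => by positivity)
    (Continuous.aestronglyMeasurable (by fun_prop))]
  exact ENNReal.toReal_le_of_le_ofReal (by positivity) hlin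

/-- The jumps of size at most `r`, rescaled by `1 / r`, with intensity multiplied by `s`. -/
noncomputable def rescaledSmallJumps (ν : Measure (EuclideanSpace ℝ (Fin d))) (r : ℝ) (s : ℝ≥0) :
    Measure (EuclideanSpace ℝ (Fin d)) :=
  (s • ν.restrict (Metric.closedBall 0 r)).map (fun z => r⁻¹ • z)

theorem integral_rescaledSmallJumps {V : Type*} [NormedAddCommGroup V] [NormedSpace ℝ V] {r : ℝ}
    (hr : 0 < r) (s : ℝ≥0) (g : EuclideanSpace ℝ (Fin d) → V) :
    ∫ y, g y ∂(rescaledSmallJumps ν r s)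
      = (s : ℝ) • ∫ z in Metric.closedBall 0 r, g (r⁻¹ • z) ∂ν := by
  have he : MeasurableEmbedding (fun z : EuclideanSpace ℝ (Fin d) => r⁻¹ • z) :=
    measurableEmbedding_const_smul₀ (by positivity)
  rw [rescaledSmallJumps, he.integral_map, integral_smul_nnreal_measure]
  rfl

theorem ae_norm_le_one_rescaledSmallJumps {r : ℝ} (hr : 0 < r) (s : ℝ≥0) :
    ∀ᵐ y ∂(rescaledSmallJumps ν r s), ‖y‖ ≤ 1 := by
  rw [rescaledSmallJumps, ae_map_iff (by fun_prop) (measurableSet_le measurable_norm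
    measurable_const)]
  refine Measure.ae_smul_measure ?_ s
  refine (ae_restrict_iff' measurableSet_closedBall).2 (.of_forall fun z hz => ?_)
  rw [mem_closedBall_zero_iff] at hz
  rw [norm_smul, Real.norm_of_nonneg (by positivity), inv_mul_le_iff₀ hr, mul_one]
  exact hz

theorem IsLevyMeasure.integrable_min_smul (hν : IsLevyMeasure ν) {r : ℝ} (hr : 0 < r)
    (hr1 : r ≤ 1) : Integrable (fun z => min 1 (‖r⁻¹ • z‖ ^ 2)) ν := by
  refine (hν.integrable_min.const_mul (r⁻¹ ^ 2)).mono' (Continuous.aestronglyMeasurable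
    (by fun_prop)) (.of_forall fun z => ?_)
  rw [Real.norm_of_nonneg (by positivity), norm_smul, Real.norm_of_nonneg (by positivity), mul_pow,
    mul_min_of_nonneg _ _ (by positivity), mul_one]
  exact min_le_min (one_le_pow₀ ((one_le_inv₀ hr).2 hr1)) le_rfl

theorem norm_sq_smul_eq_min {r : ℝ} (hr : 0 < r) {z : EuclideanSpace ℝ (Fin d)}
    (hz : z ∈ Metric.closedBall 0 r) : ‖r⁻¹ • z‖ ^ 2 = min 1 (‖r⁻¹ • z‖ ^ 2) := by
  rw [mem_closedBall_zero_iff] at hz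
  refine (min_eq_right (pow_le_one₀ (norm_nonneg _) ?_)).symm
  rw [norm_smul, Real.norm_of_nonneg (by positivity), inv_mul_le_iff₀ hr, mul_one]
  exact hz

theorem IsLevyMeasure.integrable_sq_rescaledSmallJumps (hν : IsLevyMeasure ν) {r : ℝ}
    (hr : 0 < r) (hr1 : r ≤ 1) (s : ℝ≥0) :
    Integrable (fun y => ‖y‖ ^ 2) (rescaledSmallJumps ν r s) := by
  have he : MeasurableEmbedding (fun z : EuclideanSpace ℝ (Fin d) => r⁻¹ • z) :=
    measurableEmbedding_const_smul₀ (by positivity)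
  rw [rescaledSmallJumps, he.integrable_map_iff]
  refine Integrable.smul_measure_nnreal ?_
  refine ((hν.integrable_min_smul hr hr1).integrableOn).congr ?_
  exact (ae_restrict_iff' measurableSet_closedBall).2
    (.of_forall fun z hz => (norm_sq_smul_eq_min hr hz).symm)

theorem IsLevyMeasure.integral_sq_rescaledSmallJumps_le (hν : IsLevyMeasure ν) {r : ℝ}
    (hr : 0 < r) (hr1 : r ≤ 1) (s : ℝ≥0) :
    ∫ y, ‖y‖ ^ 2 ∂(rescaledSmallJumps ν r s) ≤ s * ∫ z, min 1 (‖r⁻¹ • z‖ ^ 2) ∂ν := by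
  rw [integral_rescaledSmallJumps hr, smul_eq_mul]
  gcongr
  rw [setIntegral_congr_fun measurableSet_closedBall fun z hz => norm_sq_smul_eq_min hr hz]
  exact setIntegral_le_integral (hν.integrable_min_smul hr hr1) (.of_forall fun z => by positivity)

/-- For `|z| ≤ r ≤ 1` both `z` and `z/r` lie in the unit ball, so the truncation is one on both
sides and the dilation creates no drift. -/
theorem symbol_rescaledSmallJumps {r : ℝ} (hr : 0 < r) (hr1 : r ≤ 1) (s : ℝ≥0)
    (u : EuclideanSpace ℝ (Fin d)) :
    symbol (rescaledSmallJumps ν r s) u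
      = symbol (s • ν.restrict (Metric.closedBall 0 r)) (r⁻¹ • u) := by
  rw [symbol_smul, symbol_eq, symbol_eq, integral_rescaledSmallJumps hr, Complex.real_smul, mul_neg]
  congr 2
  refine setIntegral_congr_fun measurableSet_closedBall fun z hz => ?_
  have h1 : ‖r⁻¹ • z‖ ≤ 1 := by
    have := min_le_left (1 : ℝ) (‖r⁻¹ • z‖ ^ 2)
    rw [← norm_sq_smul_eq_min hr hz] at this
    exact (sq_le_one_iff₀ (norm_nonneg _)).1 this
  rw [mem_closedBall_zero_iff] at hz
  beta_reduce
  rw [levyIntegrand_of_norm_le_one _ h1, levyIntegrand_of_norm_le_one _ (hz.trans hr1),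
    real_inner_smul_left, real_inner_smul_right]

/-- The discarded jumps satisfy `|z/r| > 1`, where the minimum is one and `1 - cos ≤ 2`. -/
theorem IsLevyMeasure.re_symbol_rescaledSmallJumps_ge (hν : IsLevyMeasure ν) {r : ℝ}
    (hr : 0 < r) (hr1 : r ≤ 1) (s : ℝ≥0) (u : EuclideanSpace ℝ (Fin d)) :
    s * (symbol ν (r⁻¹ • u)).re - 2 * (s * ∫ z, min 1 (‖r⁻¹ • z‖ ^ 2) ∂ν)
      ≤ (symbol (rescaledSmallJumps ν r s) u).re := by
  set B : Set (EuclideanSpace ℝ (Fin d)) := Metric.closedBall 0 r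
  have hB : MeasurableSet B := measurableSet_closedBall
  have hi := hν.integrable_one_sub_cos (r⁻¹ • u)
  have hm := hν.integrable_min_smul hr hr1
  have h1 : ∫ z in Bᶜ, (1 - Real.cos ⟪r⁻¹ • u, z⟫) ∂ν
      ≤ 2 * ∫ z, min 1 (‖r⁻¹ • z‖ ^ 2) ∂ν := by
    rw [← integral_const_mul]
    refine le_trans (setIntegral_mono_on hi.integrableOn (hm.const_mul 2).integrableOn hB.compl
      fun z hz => ?_) (setIntegral_le_integral (hm.const_mul 2) (.of_forall fun z => ?_))
    · have h2 : 1 ≤ ‖r⁻¹ • z‖ := by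
        simp only [B, mem_compl_iff, mem_closedBall_zero_iff, not_le] at hz
        rw [norm_smul, Real.norm_of_nonneg (by positivity), le_inv_mul_iff₀ hr, mul_one]
        exact hz.le
      rw [min_eq_left (one_le_pow₀ h2)]
      linarith [Real.neg_one_le_cos ⟪r⁻¹ • u, z⟫]
    · simp only [Pi.zero_apply]
      positivity
  have h3 := integral_add_compl hB hi
  rw [← hν.re_symbol] at h3
  rw [symbol_rescaledSmallJumps hr hr1, symbol_smul, Complex.re_ofReal_mul,
    (hν.mono Measure.restrict_le_self).re_symbol]
  have hs : (0 : ℝ) ≤ s := s.2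
  nlinarith

end SmallJumps

/-- Domination of σ-finite measures allows subtraction. -/
theorem exists_add_eq_of_le {X : Type*} [MeasurableSpace X] {μ ν : Measure X} [SigmaFinite μ]
    [SigmaFinite ν] (h : μ ≤ ν) : ∃ ν' : Measure X, ν' + μ = ν := by
  have h1 := Measure.rnDeriv_le_one_of_le h
  -- Both measures may be infinite, so the difference is taken at the level of densities with
  -- respect to `ν`.
  refine ⟨ν.withDensity fun x => 1 - μ.rnDeriv ν x, ?_⟩
  have h2 : ν.withDensity (μ.rnDeriv ν) = μ :=
    Measure.withDensity_rnDeriv_eq μ ν (Measure.absolutelyContinuous_of_le h)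
  calc _ = ν.withDensity (fun x => 1 - μ.rnDeriv ν x) + ν.withDensity (μ.rnDeriv ν) := by rw [h2]
    _ = ν.withDensity 1 := by
      rw [← withDensity_add_right _ (Measure.measurable_rnDeriv μ ν)]
      refine withDensity_congr_ae ?_
      filter_upwards [h1] with x hx
      exact tsub_add_cancel_of_le hx
    _ = ν := withDensity_one

end LevyGradient

/-! ### Factorization of the law and the gradient estimate -/

namespace LevyGradient

open scoped RealInnerProductSpace

variable {d : ℕ}

/-- Lower bound for the symbol of the rescaled small jumps, uniform in the scale. -/
theorem IsLevyMeasure.re_symbol_rescaledSmallJumps_ge_rpow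
    {ν : Measure (EuclideanSpace ℝ (Fin d))} (hν : IsLevyMeasure ν) {α c M C r : ℝ} (hα : 0 < α)
    (hc : 0 ≤ c) (hM : 0 ≤ M)
    (hψ : ∀ y, M < ‖y‖ → c * ‖y‖ ^ α ≤ (symbol ν y).re) (hr : 0 < r) (hr1 : r ≤ 1) {s : ℝ≥0}
    (hs : (s : ℝ) = r ^ α) (hC : s * ∫ z, min 1 (‖r⁻¹ • z‖ ^ 2) ∂ν ≤ C)
    (w : EuclideanSpace ℝ (Fin d)) :
    c * ‖w‖ ^ α - (2 * C + c * M ^ α)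
      ≤ (symbol (rescaledSmallJumps ν r s) ((2 * Real.pi) • w)).re := by
  have h1 := hν.re_symbol_rescaledSmallJumps_ge hr hr1 s ((2 * Real.pi) • w)
  set u := r⁻¹ • (2 * Real.pi) • w with hu
  have hs1 : (s : ℝ) ≤ 1 := hs ▸ Real.rpow_le_one hr.le hr1 hα.le
  -- The weight `s = r^α` cancels the factor `r⁻¹` in `u`, and `2π ≥ 1`.
  have h2 : ‖w‖ ^ α ≤ s * ‖u‖ ^ α := by
    rw [hs, ← Real.mul_rpow hr.le (norm_nonneg _)]
    refine Real.rpow_le_rpow (norm_nonneg _) ?_ hα.le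
    rw [hu, norm_smul, norm_smul, Real.norm_of_nonneg (by positivity),
      Real.norm_of_nonneg (by positivity), mul_inv_cancel_left₀ hr.ne']
    nlinarith [norm_nonneg w, Real.pi_gt_three]
  -- When `|u| ≤ M` the growth hypothesis is silent, but then `s|u|^α ≤ M^α` and `Re ψ ≥ 0`, so an
  -- error `c M^α` suffices.
  have h3 : c * (s * ‖u‖ ^ α) ≤ s * (symbol ν u).re + c * M ^ α := by
    have hM' : 0 ≤ c * M ^ α := by positivity
    rcases lt_or_ge M ‖u‖ with h | h
    · have := mul_le_mul_of_nonneg_left (hψ u h) s.coe_nonneg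
      linarith
    · have h4 : 0 ≤ s * (symbol ν u).re := mul_nonneg s.coe_nonneg (hν.re_symbol_nonneg u)
      have h5 : (s : ℝ) * ‖u‖ ^ α ≤ 1 * M ^ α :=
        mul_le_mul hs1 (Real.rpow_le_rpow (norm_nonneg _) h hα.le) (by positivity) zero_le_one
      have h6 := mul_le_mul_of_nonneg_left h5 hc
      linarith
  have h7 := mul_le_mul_of_nonneg_left h2 hc
  linarith

/-- Factorization of the characteristic function of `r⁻¹ L_t` into the contributions of the small
jumps governed by `ν₁` and of all other jumps. -/
theorem exists_isFourierContraction_charFun_eq {Ω : Type*} [MeasurableSpace Ω] {P : Measure Ω}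
    {L : ℝ≥0 → Ω → EuclideanSpace ℝ (Fin d)} {ν ν₁ : Measure (EuclideanSpace ℝ (Fin d))}
    (hL : IsPureJump P L ν) (hle : ν₁ ≤ ν) {t s : ℝ≥0} (hLt : Measurable (L t)) (hst : s ≤ t)
    {r : ℝ} (hr : 0 < r) (hr1 : r ≤ 1) :
    ∃ χ : EuclideanSpace ℝ (Fin d) → ℂ, IsFourierContraction χ ∧
      ∀ w, charFun (P.map fun ω => r⁻¹ • L t ω) ((2 * Real.pi) • w)
        = χ w * Complex.exp (-symbol (rescaledSmallJumps ν₁ r s) ((2 * Real.pi) • w)) := by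
  have hm : Measurable fun ω => r⁻¹ • L t ω := hLt.const_smul r⁻¹
  have hν := hL.isLevyMeasure.smul t
  have hle' : s • ν₁.restrict (Metric.closedBall 0 r) ≤ t • ν := by
    refine Measure.le_iff.2 fun A hA => ?_
    rw [Measure.smul_apply, Measure.smul_apply, ENNReal.smul_def, ENNReal.smul_def, smul_eq_mul,
      smul_eq_mul]
    gcongr
    exact Measure.restrict_le_self.trans hle
  have hν₁ := hν.mono hle'
  have := hν.sigmaFinite
  have := hν₁.sigmaFinite
  -- `ν'` carries all jumps of `t • ν` outside the selected part. It is again a Lévy measure, hence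
  -- its factor is a contraction.
  obtain ⟨ν', hν'⟩ := exists_add_eq_of_le hle'
  have hν'L : IsLevyMeasure ν' := hν.mono (hν' ▸ Measure.le_add_right le_rfl)
  refine ⟨_, hν'L.isFourierContraction_exp_neg_symbol (r⁻¹ * (2 * Real.pi)), fun w => ?_⟩
  rw [symbol_rescaledSmallJumps hr hr1, ← Complex.exp_add, mul_smul r⁻¹, ← neg_add,
    ← symbol_add hν'L hν₁, hν', symbol_smul, ← hL.charFun_eq, charFun_apply,
    integral_map hm.aemeasurable (Continuous.aestronglyMeasurable (by fun_prop))]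
  simp only [real_inner_smul_left, real_inner_smul_right, mul_comm Complex.I, real_inner_comm w,
    mul_left_comm r⁻¹]

theorem semigroup_eq {Ω : Type*} [MeasurableSpace Ω] {P : Measure Ω}
    {L : ℝ≥0 → Ω → EuclideanSpace ℝ (Fin d)} {t : ℝ≥0} (hLt : Measurable (L t)) {r : ℝ}
    (hr : r ≠ 0) (f F : EuclideanSpace ℝ (Fin d) →ᵇ ℝ) (hF : ∀ x, F x = f (r • x)) :
    semigroup P L t f
      = fun x => (fun x => ∫ y, F (x + y) ∂(P.map fun ω => r⁻¹ • L t ω)) (r⁻¹ • x) := by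
  have hm : Measurable fun ω => r⁻¹ • L t ω := hLt.const_smul r⁻¹
  ext x
  beta_reduce
  rw [semigroup, integral_map hm.aemeasurable
    (Continuous.aestronglyMeasurable (by fun_prop))]
  simp only [hF, ← smul_add, smul_inv_smul₀ hr]

/-- The gradient bound at a fixed time, with the scale `r = (t ∧ 1)^{1/α}`. -/
theorem exists_contDiff_semigroup_and_norm_fderiv_le {Ω : Type*} [MeasurableSpace Ω]
    {P : Measure Ω} [IsProbabilityMeasure P] {L : ℝ≥0 → Ω → EuclideanSpace ℝ (Fin d)}
    (hLm : ∀ t, Measurable (L t)) {ν ν₁ : Measure (EuclideanSpace ℝ (Fin d))}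
    (hL : IsPureJump P L ν) (hν₁ : IsLevyMeasure ν₁) (hle : ν₁ ≤ ν) {α c₁ c₂ M : ℝ}
    (hα : α ∈ Ioo (0 : ℝ) 2) (hc₁ : 0 < c₁) (hc₂ : 0 < c₂) (hM : 0 < M)
    (hψ₁ : ∀ y, M < ‖y‖ → c₁ * ‖y‖ ^ α ≤ (symbol ν₁ y).re ∧ (symbol ν₁ y).re ≤ c₂ * ‖y‖ ^ α) :
    ∃ K : ℝ≥0, ∀ t : ℝ≥0, 0 < t → ∀ f : EuclideanSpace ℝ (Fin d) →ᵇ ℝ,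
      ContDiff ℝ 1 (semigroup P L t f) ∧
        ∀ x, ‖fderiv ℝ (semigroup P L t f) x‖ ≤ (((min t 1 : ℝ≥0) : ℝ) ^ (1 / α))⁻¹ * (K * ‖f‖) := by
  obtain ⟨C, hC0, hC⟩ := hν₁.exists_integral_min_le hα.1.le hα.2.le hc₂.le
    (fun y hy => (hψ₁ y hy).2)
  obtain ⟨K, hK⟩ := exists_lintegral_fourier_exp_neg_symbol_le d hα.1 hc₁ (2 * C + c₁ * M ^ α) C
  refine ⟨K, fun t ht f => ?_⟩
  -- Capping the time at one keeps `r ≤ 1`, as the scaling estimates require; for `t > 1` the excess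
  -- time is absorbed into `χ`.
  set s : ℝ≥0 := min t 1
  have hs0 : (0 : ℝ) < s := NNReal.coe_pos.2 (lt_min ht one_pos)
  have hs1 : (s : ℝ) ≤ 1 := by exact_mod_cast min_le_right t 1
  obtain ⟨r, hrs⟩ : ∃ r, r = (s : ℝ) ^ (1 / α) := ⟨_, rfl⟩
  have hr : 0 < r := hrs ▸ Real.rpow_pos_of_pos hs0 _
  have hr1 : r ≤ 1 := hrs ▸ Real.rpow_le_one hs0.le hs1 (by have := hα.1; positivity)
  have hsr : (s : ℝ) = r ^ α := by
    rw [hrs, ← Real.rpow_mul hs0.le, one_div_mul_cancel hα.1.ne', Real.rpow_one]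
  have hCs : s * ∫ z, min 1 (‖r⁻¹ • z‖ ^ 2) ∂ν₁ ≤ C := by
    have := mul_le_mul_of_nonneg_left (hC r hr hr1) s.coe_nonneg
    refine this.trans (le_of_eq ?_)
    rw [hsr]
    field_simp
  obtain ⟨hf, hf', hKf, hKf'⟩ := hK (rescaledSmallJumps ν₁ r s)
    (ae_norm_le_one_rescaledSmallJumps hr s) (hν₁.integrable_sq_rescaledSmallJumps hr hr1 s)
    ((hν₁.integral_sq_rescaledSmallJumps_le hr hr1 s).trans hCs)
    (hν₁.re_symbol_rescaledSmallJumps_ge_rpow hα.1 hc₁.le hM.le (fun y hy => (hψ₁ y hy).1) hr hr1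
      hsr hCs)
  obtain ⟨χ, hχ, hχe⟩ :=
    exists_isFourierContraction_charFun_eq hL hle (hLm t) (min_le_left t 1) hr hr1
  have hm : Measurable fun ω => r⁻¹ • L t ω := (hLm t).const_smul r⁻¹
  have : IsProbabilityMeasure (P.map fun ω => r⁻¹ • L t ω) :=
    Measure.isProbabilityMeasure_map hm.aemeasurable
  set F := f.compContinuous ⟨fun x => r • x, by fun_prop⟩
  have hFf : ‖F‖ ≤ ‖f‖ :=
    (BoundedContinuousFunction.norm_le (norm_nonneg f)).2 fun x => f.norm_coe_le_norm _
  obtain ⟨h1, h2⟩ := contDiff_and_norm_fderiv_le_of_charFun_eq hχ hχe hf hf' hKf hKf' F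
  rw [semigroup_eq (hLm t) hr.ne' f F fun x => rfl, ← hrs]
  refine ⟨h1.comp (contDiff_const_smul r⁻¹), fun x => ?_⟩
  -- The chain rule for the dilation by `r⁻¹` produces the factor `(t ∧ 1)^{-1/α}`.
  have h3 := fderiv_comp_smul (𝕜 := ℝ) (x := x)
    (f := fun x => ∫ y, F (x + y) ∂(P.map fun ω => r⁻¹ • L t ω)) r⁻¹
  rw [h3, norm_smul, Real.norm_of_nonneg (by positivity)]
  gcongr
  exact (h2 _).trans (by gcongr)

end LevyGradient

theorem proposition3p3 {d : ℕ} (hd : 1 ≤ d)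
    {Ω : Type*} [mΩ : MeasurableSpace Ω] (P : Measure Ω) [IsProbabilityMeasure P]
    (ℱ : Filtration ℝ≥0 mΩ) (L : ℝ≥0 → Ω → EuclideanSpace ℝ (Fin d))
    (hL : LevyGradient.IsLevyProcess ℱ P L)
    (ν : Measure (EuclideanSpace ℝ (Fin d))) (hLν : LevyGradient.IsPureJump P L ν)
    (ν₁ : Measure (EuclideanSpace ℝ (Fin d))) (hν₁ : LevyGradient.IsLevyMeasure ν₁)
    (hle : ∀ A : Set (EuclideanSpace ℝ (Fin d)), MeasurableSet A → ν₁ A ≤ ν A)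
    (α : ℝ) (hα : α ∈ Ioo (0 : ℝ) 2) (c₁ c₂ M : ℝ) (hc₁ : 0 < c₁) (hc₂ : 0 < c₂) (hM : 0 < M)
    (hψ₁ : ∀ y : EuclideanSpace ℝ (Fin d), M < ‖y‖ →
      c₁ * ‖y‖ ^ α ≤ (LevyGradient.symbol ν₁ y).re ∧
        (LevyGradient.symbol ν₁ y).re ≤ c₂ * ‖y‖ ^ α) :
    LevyGradient.GradientHypothesis (LevyGradient.semigroup P L) α := by
  have hLm : ∀ t, Measurable (L t) := fun t => (hL.adapted t).mono (ℱ.le t) le_rfl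
  obtain ⟨K, hK⟩ := LevyGradient.exists_contDiff_semigroup_and_norm_fderiv_le hLm hLν hν₁
    (Measure.le_iff.2 hle) hα hc₁ hc₂ hM hψ₁
  -- The constant `K + 1` is used because `K` may vanish while a strictly positive constant is
  -- required.
  refine ⟨hα, fun t ht f => ⟨(hK t ht f).1, ⟨‖f‖, fun x => ?_⟩, ⟨_, (hK t ht f).2⟩⟩,
    ⟨K + 1, by positivity, fun f t ht ht1 x => ?_⟩⟩
  · rw [LevyGradient.semigroup, ← Real.norm_eq_abs]
    simpa using norm_integral_le_of_norm_le_const (μ := P)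
      (.of_forall fun ω => f.norm_coe_le_norm (x + L t ω))
  · refine ((hK t ht f).2 x).trans ?_
    rw [min_eq_left ht1, div_eq_inv_mul _ ((t : ℝ) ^ (1 / α)), mul_assoc]
    gcongr
    linarith
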